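/- **Setting.** A classifier with constraints consists of: a number $n$ of features; a set $\mathcal P\subseteq\{1,\dots,n\}$ of protected features; a domain for each feature; a set $\mathbb F[\mathcal C]$ of instances, contained in the feature space $\mathbb F$ (the product of the domains), namely those that satisfy the constraints; and a map $\kappa$ from $\mathbb F[\mathcal C]$ to a set of classes. Let $x\in\mathbb F[\mathcal C]$ and let $x_S$ denote the restriction of $x$ to a set $S$ of features. - $S$ is a *weak AXp* of $\langle\kappa,x\rangle$ if every $y\in\mathbb F[\mathcal C]$ with $y_S=x_S$ satisfies $\kappa(y)=\kappa(x)$. An *AXp* is a subset-minimal weak AXp. - $A$ *subsumes* $B$ if every $y\in\mathbb F[\mathcal C]$ with $y_B=x_B$ satisfies $y_A=x_A$; it *strictly subsumes* $B$ if moreover $B$ does not subsume $A$. - A *PI-explanation* of $\langle\kappa,x\rangle$ is an AXp that is not strictly subsumed by another AXp. It is *fair* if it contains no protected feature. - $\kappa$ is *existentially fair* if for every $x\in\mathbb F[\mathcal C]$ some PI-explanation of $\langle\kappa,x\rangle$ is fair, and *universally fair* if for every $x\in\mathbb F[\mathcal C]$ all PI-explanations of $\langle\kappa,x\rangle$ are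 fair. Classifiers are given to an algorithm by descriptions, which are binary words; feature values and classes are named by binary words. Fix any such way of describing classifiers for which the following hold (time and length bounds are polynomial in the length of the input, for the length bound in (c) in the length of the description): (a) it can be decided in polynomial time whether a word is a description; (b) the list of the features, each marked as protected or unprotected, can be computed from the description in polynomial time; (c) the feature values of the instances in $\mathbb F[\mathcal C]$ have polynomial length, and, given a description and a list of words, it can be decided in polynomial time whether the list is an instance in $\mathbb F[\mathcal C]$; (d) given a description and an instance $x\in\mathbb F[\mathcal C]$, the class $\kappa(x)$ can be computed in polynomial time. Here $\Pi_k^{\mathrm P}$ is the class of languages $L\subseteq\{0,1\}^*$ for which there are a polynomial $q$ and a polynomial-time decidable relation $V$ such that $w\in L$ if and only if $\forall u_1\,\exists u_2\,\forall u_3\cdots V(w,u_1,\dots,u_k)$, with $k$ alternating quantifiers over binary words of length at most $q(|w|)$. **Proposition.** The problem of testing, given a description of a classifier, whether the classifier is existentially fair belongs to $\Pi_4^{\mathrm P}$. The problem of testing, given a description of a classifier, whether the classifier is universally fair belongs to $\Pi_3^{\mathrm P}$. -/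

import Mathlib

/-! ### Explanations and fairness in a constrained feature space

`ι` is the set of features, `D i` the domain of feature `i`, so that `∀ i, D i` is the feature
space `𝔽`. The set `C : Set (∀ i, D i)` is `𝔽[𝒞]`, the set of instances that satisfy the
constraints, and a classifier is a function `κ : C → K`. -/

namespace Fairness

universe u v w

variable {ι : Type u} {D : ι → Type v} {K : Type w} {C : Set (∀ i, D i)}

/-- `y_S = x_S`. -/
def AgreeOn (S : Set ι) (y x : ∀ i, D i) : Prop := ∀ i ∈ S, y i = x i

/-- `S` is a weak abductive explanation (weak AXp) of the decision `κ(x)`. -/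
def IsWeakAXp (κ : C → K) (x : C) (S : Set ι) : Prop :=
  ∀ y : C, AgreeOn S y.1 x.1 → κ y = κ x

/-- An AXp is a subset-minimal weak AXp. -/
def IsAXp (κ : C → K) (x : C) (S : Set ι) : Prop := Minimal (IsWeakAXp κ x) S

/-- `A` subsumes `B` at `x`: in `𝔽[𝒞]` the partial assignment `x_B` implies `x_A`. -/
def Subsumes (x : C) (A B : Set ι) : Prop :=
  ∀ y : C, AgreeOn B y.1 x.1 → AgreeOn A y.1 x.1

/-- `A` subsumes `B` at `x`, but `B` does not subsume `A`. -/
def StrictlySubsumes (x : C) (A B : Set ι) : Prop := Subsumes x A B ∧ ¬ Subsumes x B A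

/-- A prime-implicant explanation: an AXp not strictly subsumed by another AXp. -/
def IsPIExplanation (κ : C → K) (x : C) (S : Set ι) : Prop :=
  IsAXp κ x S ∧ ¬ ∃ T, IsAXp κ x T ∧ StrictlySubsumes x T S

/-- An explanation is fair if it contains no protected feature. -/
def IsFairExplanation (P S : Set ι) : Prop := Disjoint S P

/-- The decision `κ(x)` has a fair PI-explanation. -/
def IsExistentiallyFairDecision (P : Set ι) (κ : C → K) (x : C) : Prop :=
  ∃ S, IsPIExplanation κ x S ∧ IsFairExplanation P S

/-- All PI-explanations of the decision `κ(x)` are fair. -/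
def IsUniversallyFairDecision (P : Set ι) (κ : C → K) (x : C) : Prop :=
  ∀ S, IsPIExplanation κ x S → IsFairExplanation P S

/-- Every decision of the classifier is existentially fair. -/
def IsExistentiallyFair (P : Set ι) (κ : C → K) : Prop :=
  ∀ x : C, IsExistentiallyFairDecision P κ x

/-- Every decision of the classifier is universally fair. -/
def IsUniversallyFair (P : Set ι) (κ : C → K) : Prop :=
  ∀ x : C, IsUniversallyFairDecision P κ x

end Fairness

/-! ### The polynomial hierarchy -/

namespace PolyHierarchy

/-- Binary words. -/
abbrev Word : Type := List Bool

/-- A tuple of binary words as a word over `{0, 1, #}`: every component is followed by the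
end marker `# = none`. -/
def encodeTuple (ws : List Word) : List (Option Bool) :=
  ws.flatMap fun w => w.map some ++ [none]

/-- `f` is computable by a Turing machine in time polynomial in the length of the encoded
input. -/
def PolyTime {α β αΓ βΓ : Type} (ea : α → List αΓ) (eb : β → List βΓ) (f : α → β) : Prop :=
  Nonempty (Turing.TM2ComputableInPolyTime ea eb f)

/-- `k` alternating quantifiers over binary words of length at most `m`, in front of the
predicate `R`; the first one is `∀` if the flag is `true` and `∃` if it is `false`. -/
def Alternating (m : ℕ) : (k : ℕ) → Bool → (List.Vector Word k → Prop) → Prop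
  | 0, _, R => R List.Vector.nil
  | k + 1, true, R =>
      ∀ u : Word, u.length ≤ m → Alternating m k false fun us => R (List.Vector.cons u us)
  | k + 1, false, R =>
      ∃ u : Word, u.length ≤ m ∧ Alternating m k true fun us => R (List.Vector.cons u us)

/-- The level `Π_k^P`: the languages `L` for which there are a polynomial `q` and a polynomial
time decidable relation `V` such that
`w ∈ L ↔ ∀ u₁ ∃ u₂ ∀ u₃ ⋯ V (w, u₁, …, u_k)`, where `|u_j| ≤ q(|w|)`. -/
def PiP (k : ℕ) : Set (Set Word) :=
  {L | ∃ (q : Polynomial ℕ) (V : List.Vector Word (k + 1) → Bool),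
    PolyTime (fun v => encodeTuple v.toList) Computability.encodeBool V ∧
    ∀ w : Word, w ∈ L ↔
      Alternating (q.eval w.length) k true fun us => V (List.Vector.cons w us) = true}

end PolyHierarchy

/-! ### Classifiers as inputs of a decision problem -/

namespace Fairness

open PolyHierarchy

/-- A classifier on a constrained feature space with its protected features. Feature values and
classes are named by binary words. -/
structure Classifier where
  /-- the number of features -/
  n : ℕ
  /-- which features are protected -/
  isProtected : Fin n → Bool
  /-- the domains of the features -/
  dom : Fin n → Set Word
  /-- `𝔽[𝒞]`, the set of instances that satisfy the constraints -/
  feasible : Set (∀ i, dom i)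
  /-- the class of an instance of `𝔽[𝒞]` -/
  κ : feasible → Word

namespace Classifier

/-- The set `𝒫` of protected features. -/
def protectedFeatures (c : Classifier) : Set (Fin c.n) := {i | c.isProtected i = true}

/-- A feature vector as the list of its `n` values. -/
def toWords (c : Classifier) (x : ∀ i, c.dom i) : List Word := List.ofFn fun i => (x i : Word)

end Classifier

/-- A way of describing classifiers by binary words: the admissible descriptions, and the
classifier that each of them describes. -/
structure ClassifierScheme where
  /-- the words that describe a classifier -/
  codes : Set Word
  /-- the classifier that is described -/
  classifier : codes → Classifier

namespace ClassifierScheme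

open Classical in
/-- The computational assumptions on a class of classifiers that is given by descriptions:
descriptions are recognizable in polynomial time; the list of features, each flagged as
protected or not, can be read off in polynomial time; instances of `𝔽[𝒞]` have values of
polynomial length and are recognizable in polynomial time; and `κ(x)` can be computed in
polynomial time for `x ∈ 𝔽[𝒞]`. All bounds are in terms of the length of the input. -/
structure IsPolyTime (S : ClassifierScheme) : Prop where
  codes_polyTime :
    PolyTime (fun r : Word => r) Computability.encodeBool (fun r => decide (r ∈ S.codes))
  features_polyTime :
    PolyTime (fun r : S.codes => (r : Word)) (fun b : Word => b)
      (fun r => List.ofFn (S.classifier r).isProtected)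
  values_length :
    ∃ p : Polynomial ℕ, ∀ (r : S.codes), ∀ x ∈ (S.classifier r).feasible,
      ∀ i, (x i : Word).length ≤ p.eval (r : Word).length
  feasible_polyTime :
    PolyTime (fun a : S.codes × List Word => encodeTuple ((a.1 : Word) :: a.2))
      Computability.encodeBool
      (fun a => decide (∃ x ∈ (S.classifier a.1).feasible, (S.classifier a.1).toWords x = a.2))
  classify_polyTime :
    PolyTime
      (fun a : (r : S.codes) × (S.classifier r).feasible =>
        encodeTuple ((a.1 : Word) :: (S.classifier a.1).toWords a.2.1))
      (fun b : Word => b)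
      (fun a => (S.classifier a.1).κ a.2)

/-- The problem: given the description of a classifier, is the classifier existentially fair? -/
def existentialFairnessProblem (S : ClassifierScheme) : Set Word :=
  {w | ∃ h : w ∈ S.codes,
    IsExistentiallyFair (S.classifier ⟨w, h⟩).protectedFeatures (S.classifier ⟨w, h⟩).κ}

/-- The problem: given the description of a classifier, is the classifier universally fair? -/
def universalFairnessProblem (S : ClassifierScheme) : Set Word :=
  {w | ∃ h : w ∈ S.codes,
    IsUniversallyFair (S.classifier ⟨w, h⟩).protectedFeatures (S.classifier ⟨w, h⟩).κ}

end ClassifierScheme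

end Fairness

/-! The heart of the matter is a two-quantifier description of PI-explanations. The definition
compares `S` with other AXps, and being an AXp is itself a quantified condition. Over finitely many
features, however, every weak AXp `T` contains an AXp `T'`; if `T` subsumes `S` then so does `T'`,
and if `S` does not subsume `T` then it does not subsume `T'`. Hence (`isPIExplanation_iff`) `S` is
a PI-explanation iff it is a weak AXp and every weak AXp `T` subsuming `S` is subsumed by `S` and is
not a proper subset of `S`.

Spelled out for a given `T`: some `y` shows that `T` is not a weak AXp, or some `y` shows that `T`
does not subsume `S`, or `T` is not a proper subset of `S` and every `z` agreeing with `x` on `T`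
agrees on `S`. Which case applies depends on `T` only, so a single `z` can be quantified together
with `T`, and a single `y` after them. This gives `∀ (T, z) ∃ y` in front of a matrix,
`Classifier.PIMatrix`, that can be tested in polynomial time (`exists_piMatrix`,
`isPIExplanation_of_piMatrix`). Existential fairness becomes `∀ x ∃ S ∀ (T, z) ∃ y`, and universal
fairness `∀ (x, S) ∃ (T, z) ∀ y`.

A quantified word is decoded by `parts` into a mask (a set of features) and a list of words (a
candidate instance). Every word decodes to something, and words of polynomial length reach every
pair of a set and an instance (`exists_certificate`).

For the time bound, the machines given by the hypotheses are embedded into one stack machine with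
registers, which can call them, sequence them and branch (`RPoly`). The remaining work is done by
transducers that scan their tapes once. The given machines are reliable only on descriptions and
instances, so `FP` carries a domain and `FP.ite` guards the calls. -/

open Turing

namespace PolyTM

/-! ### Timed runs of stack machines -/

theorem eval_mono (p : Polynomial ℕ) {a b : ℕ} (h : a ≤ b) : p.eval a ≤ p.eval b := by
  rw [Polynomial.eval_eq_sum, Polynomial.eval_eq_sum]
  exact Finset.sum_le_sum fun i _ => Nat.mul_le_mul_left _ (Nat.pow_le_pow_left h i)

section Steps

variable {K : Type} [DecidableEq K] {Γ : K → Type} {Λ Λ' σ : Type}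

/-- `Steps M n c c'`: the machine `M` goes from `c` to `c'` in exactly `n` steps. -/
inductive Steps (M : Λ → TM2.Stmt Γ Λ σ) : ℕ → TM2.Cfg Γ Λ σ → TM2.Cfg Γ Λ σ → Prop
  | refl (c) : Steps M 0 c c
  | head {n c c' c''} : TM2.step M c = some c' → Steps M n c' c'' → Steps M (n + 1) c c''

theorem Steps.trans {M : Λ → TM2.Stmt Γ Λ σ} {m n : ℕ} {c c' c'' : TM2.Cfg Γ Λ σ}
    (h : Steps M m c c') (h' : Steps M n c' c'') : Steps M (m + n) c c'' := by
  induction h with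
  | refl c => simpa using h'
  | head e _ ih => rw [Nat.add_right_comm]; exact Steps.head e (ih h')

/-- Bridge to Mathlib's timed evaluation, which iterates the step function on optional
configurations; a run that has reached `none` stays there. -/
theorem steps_iff_iterate {M : Λ → TM2.Stmt Γ Λ σ} {n : ℕ} {c c' : TM2.Cfg Γ Λ σ} :
    Steps M n c c' ↔ (flip bind (TM2.step M))^[n] (some c) = some c' := by
  have hnone : ∀ n, (flip bind (TM2.step M))^[n] none = none := by
    intro n
    induction n with
    | zero => rfl
    | succ n ih => rw [Function.iterate_succ_apply]; exact ih
  constructor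
  · intro h
    induction h with
    | refl c => rfl
    | head e _ ih =>
      rw [Function.iterate_succ_apply, ← ih]
      congr 1
  · intro h
    induction n generalizing c with
    | zero => cases h; exact Steps.refl _
    | succ n ih =>
      rw [Function.iterate_succ_apply] at h
      change (flip bind (TM2.step M))^[n] (TM2.step M c) = _ at h
      cases e : TM2.step M c with
      | none => rw [e, hnone] at h; cases h
      | some d => rw [e] at h; exact Steps.head e (ih h)

/-- Rename the labels of a statement by `f` and replace its `halt` instructions by `h`. -/
def relabel (f : Λ → Λ') (h : TM2.Stmt Γ Λ' σ) : TM2.Stmt Γ Λ σ → TM2.Stmt Γ Λ' σ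
  | .push k a q => .push k a (relabel f h q)
  | .peek k a q => .peek k a (relabel f h q)
  | .pop k a q => .pop k a (relabel f h q)
  | .load a q => .load a (relabel f h q)
  | .branch b q q' => .branch b (relabel f h q) (relabel f h q')
  | .goto g => .goto fun v => f (g v)
  | .halt => h

/-- The effect of `relabel` on the configuration reached by a statement. -/
def relabelCfg (f : Λ → Λ') (h : TM2.Stmt Γ Λ' σ) : TM2.Cfg Γ Λ σ → TM2.Cfg Γ Λ' σ
  | ⟨some l, v, S⟩ => ⟨some (f l), v, S⟩
  | ⟨none, v, S⟩ => TM2.stepAux h v S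

theorem stepAux_relabel (f : Λ → Λ') (h : TM2.Stmt Γ Λ' σ) (q : TM2.Stmt Γ Λ σ) (v : σ)
    (S : ∀ k, List (Γ k)) :
    TM2.stepAux (relabel f h q) v S = relabelCfg f h (TM2.stepAux q v S) := by
  induction q generalizing v S with
  | branch b q q' ih ih' =>
    simp only [relabel, TM2.stepAux]
    cases b v
    · exact ih' v S
    · exact ih v S
  | goto g => rfl
  | halt => rfl
  | _ => simp only [relabel, TM2.stepAux, *]

/-- A `halt` is executed inside the last step of a run. Its replacement `h` is executed inside that
same step, so the step count does not change. -/
theorem Steps.relabel {M : Λ → TM2.Stmt Γ Λ σ} {M' : Λ' → TM2.Stmt Γ Λ' σ} {f : Λ → Λ'}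
    {h : TM2.Stmt Γ Λ' σ} (hM : ∀ l, M' (f l) = relabel f h (M l)) {n : ℕ} {l : Λ} {v v' : σ}
    {S S' : ∀ k, List (Γ k)} (H : Steps M n ⟨some l, v, S⟩ ⟨none, v', S'⟩) :
    Steps M' n ⟨some (f l), v, S⟩ (TM2.stepAux h v' S') := by
  induction n generalizing l v S with
  | zero => cases H
  | succ n ih =>
    cases H with
    | head e H =>
      simp only [TM2.step, Option.some.injEq] at e
      have e' : TM2.step M' ⟨some (f l), v, S⟩ =
          some (relabelCfg f h (TM2.stepAux (M l) v S)) := by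
        simp only [TM2.step, hM, stepAux_relabel]
      rw [e] at e'
      refine Steps.head e' ?_
      rename_i c
      rcases c with ⟨_ | l', w, T⟩
      · cases H with
        | refl => exact Steps.refl _
        | head e _ => simp [TM2.step] at e
      · exact ih H

/-- The number of `push` instructions in a statement. -/
def pushes : TM2.Stmt Γ Λ σ → ℕ
  | .push _ _ q => pushes q + 1
  | .peek _ _ q => pushes q
  | .pop _ _ q => pushes q
  | .load _ q => pushes q
  | .branch _ q q' => pushes q + pushes q'
  | .goto _ => 0
  | .halt => 0

/-- Only a push lengthens a stack. Counting both branches of a conditional is wasteful but harmless: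
any constant per statement is enough. -/
theorem length_stepAux_le (q : TM2.Stmt Γ Λ σ) (v : σ) (S : ∀ k, List (Γ k)) (k : K) :
    ((TM2.stepAux q v S).stk k).length ≤ (S k).length + pushes q := by
  induction q generalizing v S with
  | push k' a q ih =>
    refine (ih _ _).trans ?_
    simp only [pushes]
    by_cases hk : k = k'
    · subst hk; simp only [Function.update_self, List.length_cons]; omega
    · simp only [Function.update_of_ne hk]; omega
  | pop k' a q ih =>
    refine (ih _ _).trans ?_
    simp only [pushes]
    by_cases hk : k = k'
    · subst hk; simp
    · simp [Function.update_of_ne hk]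
  | branch b q q' ih ih' =>
    have := ih v S
    have := ih' v S
    simp only [TM2.stepAux, pushes]
    cases b v <;> simp only [cond_true, cond_false] <;> omega
  | goto g => simp [pushes]
  | halt => simp [pushes]
  | _ => simp only [TM2.stepAux, pushes, *]

/-- Space is bounded by time. This keeps intermediate results polynomially long, so that polynomial
time bounds compose. -/
theorem exists_growth [Fintype Λ] (M : Λ → TM2.Stmt Γ Λ σ) : ∃ g : ℕ, ∀ {n : ℕ}
    {c c' : TM2.Cfg Γ Λ σ}, Steps M n c c' →
      ∀ k, (c'.stk k).length ≤ (c.stk k).length + n * g := by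
  refine ⟨∑ l, pushes (M l), fun {n c c'} h k => ?_⟩
  induction h with
  | refl c => simp
  | head e _ ih =>
    rename_i n c _ _ _
    rcases c with ⟨_ | l, v, S⟩
    · simp [TM2.step] at e
    · simp only [TM2.step, Option.some.injEq] at e
      subst e
      have h1 := length_stepAux_le (M l) v S k
      have h2 : pushes (M l) ≤ ∑ l, pushes (M l) :=
        Finset.single_le_sum (f := fun l => pushes (M l)) (fun _ _ => Nat.zero_le _)
          (Finset.mem_univ l)
      have h3 : (n + 1) * ∑ l, pushes (M l) = n * (∑ l, pushes (M l)) + ∑ l, pushes (M l) := by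
        ring
      change _ ≤ (S k).length + _
      omega

end Steps

/-! ### Program fragments -/

/-- A program for a stack machine, with a finite set of labels and an entry point. -/
structure Frag {K : Type} (Γ : K → Type) (σ : Type) where
  /-- the labels -/
  Λ : Type
  /-- there are finitely many labels -/
  [fin : Fintype Λ]
  /-- the entry point -/
  main : Λ
  /-- the code -/
  m : Λ → TM2.Stmt Γ Λ σ

attribute [instance] Frag.fin

namespace Frag

variable {K : Type} [DecidableEq K] {Γ : K → Type} {σ : Type}

/-- `F` transforms memory and stacks `c` into `c'` in `n` steps. -/
def Run (F : Frag Γ σ) (n : ℕ) (c c' : σ × ∀ k, List (Γ k)) : Prop :=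
  Steps F.m n ⟨some F.main, c.1, c.2⟩ ⟨none, c'.1, c'.2⟩

/-- Run `F`, then `G`. -/
def seq (F G : Frag Γ σ) : Frag Γ σ where
  Λ := F.Λ ⊕ G.Λ
  main := .inl F.main
  m := Sum.elim (fun l => relabel .inl (.goto fun _ => .inr G.main) (F.m l))
    (fun l => relabel .inr .halt (G.m l))

theorem Run.seq {F G : Frag Γ σ} {m n : ℕ} {c c' c'' : σ × ∀ k, List (Γ k)}
    (h : F.Run m c c') (h' : G.Run n c' c'') : (F.seq G).Run (m + n) c c'' :=
  Steps.trans (Steps.relabel (M' := (F.seq G).m) (f := Sum.inl) (fun _ => rfl) h)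
    (Steps.relabel (M' := (F.seq G).m) (f := Sum.inr) (h := .halt) (fun _ => rfl) h')

end Frag

/-! ### Register programs with calls of other machines -/

/-- The alphabet of the registers. -/
abbrev Sym : Type := Option Bool

instance (tm : FinTM2) : Fintype tm.σ := tm.σFin
instance (tm : FinTM2) : Fintype tm.Λ := tm.ΛFin
instance (tm : FinTM2) : Fintype tm.K := tm.kFin

section Registers

variable {J : Type} (tm : J → FinTM2) (R : Type)

/-- The stacks of a register program: its registers, and the stacks of the called machines. -/
abbrev Stack : Type := R ⊕ (Σ j, (tm j).K)

/-- The alphabets of the stacks. -/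
abbrev Alphabet (k : Stack tm R) : Type :=
  Sum.elim (fun _ => Sym) (fun x : Σ j, (tm j).K => (tm x.1).Γ x.2) k

/-- The memory of a register program: a buffer and the memories of the called machines. -/
abbrev Memory : Type := Option Sym × ∀ j, (tm j).σ

/-- The initial memory. -/
def initMemory : Memory tm := (none, fun j => (tm j).initialState)

variable {tm R}

/-- The collection of stacks with given contents. -/
def contents (r : R → List Sym) (T : ∀ j k, List ((tm j).Γ k)) (k : Stack tm R) :
    List (Alphabet tm R k) :=
  match k with
  | .inl i => r i
  | .inr x => T x.1 x.2

/-- The stacks of the called machines are empty. -/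
def noStacks (tm : J → FinTM2) : ∀ j k, List ((tm j).Γ k) := fun _ _ => []

variable [DecidableEq J] [DecidableEq R]

/-- Reads an update of the dependently typed family of stacks as an update of the registers alone,
so that later arguments need not handle the dependent alphabet. -/
theorem update_contents_inl (r : R → List Sym) (T : ∀ j k, List ((tm j).Γ k)) (i : R)
    (l : List Sym) :
    Function.update (β := fun k => List (Alphabet tm R k)) (contents r T) (.inl i) l =
      contents (Function.update r i l) T := by
  funext k
  rcases k with k | ⟨j, k⟩
  · by_cases h : k = i
    · subst h
      exact (Function.update_self ..).trans
        (Function.update_self (β := fun _ : R => List Sym) k l r).symm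
    · exact (Function.update_of_ne (by simpa using h) ..).trans
        (Function.update_of_ne (β := fun _ : R => List Sym) h l r).symm
  · exact Function.update_of_ne (by simp) ..

theorem update_contents_inr (r : R → List Sym) (T : ∀ j k, List ((tm j).Γ k)) (j : J)
    (k : (tm j).K) (l : List ((tm j).Γ k)) :
    Function.update (β := fun k => List (Alphabet tm R k)) (contents r T) (.inr ⟨j, k⟩) l =
      contents r (Function.update T j (Function.update (T j) k l)) := by
  funext k'
  rcases k' with i | ⟨j', k'⟩
  · exact Function.update_of_ne (by simp) ..
  · change _ = Function.update T j (Function.update (T j) k l) j' k'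
    by_cases h : j' = j
    · subst h
      rw [Function.update_self]
      by_cases h : k' = k
      · subst h
        rw [Function.update_self]
        exact Function.update_self ..
      · rw [Function.update_of_ne h]
        exact Function.update_of_ne (by simpa using h) ..
    · rw [Function.update_of_ne h]
      exact Function.update_of_ne (by simp [h]) ..

section Instructions

variable {Λ : Type}

/-- Push on a register. -/
def pushReg (i : R) (f : Memory tm → Sym) (q : TM2.Stmt (Alphabet tm R) Λ (Memory tm)) :
    TM2.Stmt (Alphabet tm R) Λ (Memory tm) :=
  .push (.inl i) f q

/-- Pop from a register. -/
def popReg (i : R) (f : Memory tm → Option Sym → Memory tm)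
    (q : TM2.Stmt (Alphabet tm R) Λ (Memory tm)) : TM2.Stmt (Alphabet tm R) Λ (Memory tm) :=
  .pop (.inl i) f q

/-- Push on a stack of the machine `tm j`. -/
def pushOn (j : J) (k : (tm j).K) (f : Memory tm → (tm j).Γ k)
    (q : TM2.Stmt (Alphabet tm R) Λ (Memory tm)) : TM2.Stmt (Alphabet tm R) Λ (Memory tm) :=
  .push (.inr ⟨j, k⟩) f q

/-- Inspect a stack of the machine `tm j`. -/
def peekAt (j : J) (k : (tm j).K) (f : Memory tm → Option ((tm j).Γ k) → Memory tm)
    (q : TM2.Stmt (Alphabet tm R) Λ (Memory tm)) : TM2.Stmt (Alphabet tm R) Λ (Memory tm) :=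
  .peek (.inr ⟨j, k⟩) f q

/-- Pop from a stack of the machine `tm j`. -/
def popFrom (j : J) (k : (tm j).K) (f : Memory tm → Option ((tm j).Γ k) → Memory tm)
    (q : TM2.Stmt (Alphabet tm R) Λ (Memory tm)) : TM2.Stmt (Alphabet tm R) Λ (Memory tm) :=
  .pop (.inr ⟨j, k⟩) f q

variable (q : TM2.Stmt (Alphabet tm R) Λ (Memory tm)) (s : Memory tm) (r : R → List Sym)
  (T : ∀ j k, List ((tm j).Γ k))

theorem stepAux_pushReg (i : R) (f : Memory tm → Sym) :
    TM2.stepAux (pushReg i f q) s (contents r T) =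
      TM2.stepAux q s (contents (Function.update r i (f s :: r i)) T) :=
  congrArg (TM2.stepAux q s) (update_contents_inl r T i (f s :: r i))

theorem stepAux_popReg (i : R) (f : Memory tm → Option Sym → Memory tm) :
    TM2.stepAux (popReg i f q) s (contents r T) =
      TM2.stepAux q (f s (r i).head?) (contents (Function.update r i (r i).tail) T) :=
  congrArg (TM2.stepAux q _) (update_contents_inl r T i (r i).tail)

theorem stepAux_pushOn (j : J) (k : (tm j).K) (f : Memory tm → (tm j).Γ k) :
    TM2.stepAux (pushOn j k f q) s (contents r T) = TM2.stepAux q s (contents r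
      (Function.update T j (Function.update (T j) k (f s :: T j k)))) :=
  congrArg (TM2.stepAux q s) (update_contents_inr r T j k (f s :: T j k))

theorem stepAux_peekAt (j : J) (k : (tm j).K)
    (f : Memory tm → Option ((tm j).Γ k) → Memory tm) :
    TM2.stepAux (peekAt j k f q) s (contents r T) =
      TM2.stepAux q (f s (T j k).head?) (contents r T) := rfl

theorem stepAux_popFrom (j : J) (k : (tm j).K)
    (f : Memory tm → Option ((tm j).Γ k) → Memory tm) :
    TM2.stepAux (popFrom j k f q) s (contents r T) = TM2.stepAux q (f s (T j k).head?)
      (contents r (Function.update T j (Function.update (T j) k (T j k).tail))) :=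
  congrArg (TM2.stepAux q _) (update_contents_inr r T j k (T j k).tail)

end Instructions

/-- Code of the machine `tm j` as code of a register program. -/
def liftStmt (j : J) : TM2.Stmt (tm j).Γ (tm j).Λ (tm j).σ →
    TM2.Stmt (Alphabet tm R) (tm j).Λ (Memory tm)
  | .push k a q => pushOn j k (fun s => a (s.2 j)) (liftStmt j q)
  | .peek k a q => peekAt j k
      (fun s o => (s.1, Function.update s.2 j (a (s.2 j) o))) (liftStmt j q)
  | .pop k a q => popFrom j k
      (fun s o => (s.1, Function.update s.2 j (a (s.2 j) o))) (liftStmt j q)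
  | .load a q => .load (fun s => (s.1, Function.update s.2 j (a (s.2 j)))) (liftStmt j q)
  | .branch b q q' => .branch (fun s => b (s.2 j)) (liftStmt j q) (liftStmt j q')
  | .goto g => .goto fun s => g (s.2 j)
  | .halt => .halt

/-- The embedded code touches only the memory and stacks of coordinate `j`, so the simulation is
step for step and everything else is preserved. -/
theorem stepAux_liftStmt (j : J) (q : TM2.Stmt (tm j).Γ (tm j).Λ (tm j).σ)
    (b : Option Sym) (s : ∀ j, (tm j).σ) (r : R → List Sym) (T : ∀ j k, List ((tm j).Γ k)) :
    TM2.stepAux (liftStmt j q) (b, s) (contents r T) =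
      ⟨(TM2.stepAux q (s j) (T j)).l,
        (b, Function.update s j (TM2.stepAux q (s j) (T j)).var),
        contents r (Function.update T j (TM2.stepAux q (s j) (T j)).stk)⟩ := by
  induction q generalizing s T with
  | push k a q ih =>
    simp only [liftStmt, TM2.stepAux, stepAux_pushOn, ih]
    simp
  | peek k a q ih =>
    simp only [liftStmt, TM2.stepAux, stepAux_peekAt, ih]
    simp
  | pop k a q ih =>
    simp only [liftStmt, TM2.stepAux, stepAux_popFrom, ih]
    simp
  | load a q ih =>
    simp only [liftStmt, TM2.stepAux]
    rw [ih]
    simp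
  | branch b q q' ih ih' =>
    simp only [liftStmt, TM2.stepAux]
    cases b (s j)
    · exact ih' s T
    · exact ih s T
  | goto g => simp [liftStmt]
  | halt => simp [liftStmt]

theorem steps_liftStmt (j : J) {n : ℕ} {c c' : TM2.Cfg (tm j).Γ (tm j).Λ (tm j).σ}
    (h : Steps (tm j).m n c c') (b : Option Sym) (s : ∀ j, (tm j).σ) (r : R → List Sym)
    (T : ∀ j k, List ((tm j).Γ k)) :
    Steps (fun l => liftStmt (R := R) j ((tm j).m l)) n
      ⟨c.l, (b, Function.update s j c.var), contents r (Function.update T j c.stk)⟩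
      ⟨c'.l, (b, Function.update s j c'.var), contents r (Function.update T j c'.stk)⟩ := by
  induction h with
  | refl c => exact Steps.refl _
  | head e _ ih =>
    refine Steps.head ?_ ih
    rename_i c d _ _
    rcases c with ⟨_ | l, v, S⟩
    · simp [TM2.step] at e
    · simp only [TM2.step, Option.some.injEq] at e
      subst e
      simp only [TM2.step, stepAux_liftStmt]
      simp

theorem initList_eq (t : FinTM2) (l : List (t.Γ t.k₀)) :
    initList t l = ⟨some t.main, t.initialState, Function.update (fun _ => []) t.k₀ l⟩ := by
  unfold initList
  congr 1
  funext k
  by_cases h : k = t.k₀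
  · subst h; simp
  · simp [h]

theorem haltList_eq (t : FinTM2) (l : List (t.Γ t.k₁)) :
    haltList t l = ⟨none, t.initialState, Function.update (fun _ => []) t.k₁ l⟩ := by
  unfold haltList
  congr 1
  funext k
  by_cases h : k = t.k₁
  · subst h; simp
  · simp [h]

/-- Run the machine `tm j`. -/
def runFrag (R : Type) (j : J) : Frag (Alphabet tm R) (Memory tm) where
  Λ := (tm j).Λ
  main := (tm j).main
  m := fun l => liftStmt j ((tm j).m l)

/-- The contents of the stacks of the called machines when only one stack is nonempty. -/
def oneStack (j : J) (k : (tm j).K) (l : List ((tm j).Γ k)) : ∀ j k, List ((tm j).Γ k) :=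
  Function.update (noStacks tm) j (Function.update (noStacks tm j) k l)

@[simp] theorem oneStack_nil (j : J) (k : (tm j).K) : oneStack j k [] = noStacks tm := by
  have : Function.update (noStacks tm j) k [] = noStacks tm j :=
    Function.update_eq_self k (noStacks tm j)
  rw [oneStack, this, Function.update_eq_self]

/-- By Mathlib's convention a finished machine is back in its initial memory with only its output
stack nonempty. Once that stack is unloaded, the machine is ready to be called again. -/
theorem run_runFrag (j : J) {n : ℕ} {l : List ((tm j).Γ (tm j).k₀)}
    {l' : List ((tm j).Γ (tm j).k₁)}
    (h : Steps (tm j).m n (initList (tm j) l) (haltList (tm j) l')) (r : R → List Sym) :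
    (runFrag R j).Run n (initMemory tm, contents r (oneStack j _ l))
      (initMemory tm, contents r (oneStack j _ l')) := by
  rw [initList_eq, haltList_eq] at h
  have := steps_liftStmt j h none (initMemory tm).2 r (noStacks tm)
  have e : Function.update (initMemory tm).2 j (tm j).initialState = (initMemory tm).2 :=
    Function.update_eq_self j (initMemory tm).2
  simp only [e] at this
  exact this

/-- Push the contents of the buffer on each register of a list. -/
def pushAll {Λ : Type} (q : TM2.Stmt (Alphabet tm R) Λ (Memory tm)) :
    List R → TM2.Stmt (Alphabet tm R) Λ (Memory tm)
  | [] => q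
  | i :: is => pushReg i (fun s => s.1.getD none) (pushAll q is)

theorem stepAux_pushAll {Λ : Type} (q : TM2.Stmt (Alphabet tm R) Λ (Memory tm)) (is : List R)
    (his : is.Nodup) (a : Sym) (s : ∀ j, (tm j).σ) (r : R → List Sym)
    (T : ∀ j k, List ((tm j).Γ k)) :
    TM2.stepAux (pushAll q is) (some a, s) (contents r T) =
      TM2.stepAux q (some a, s) (contents (fun i => if i ∈ is then a :: r i else r i) T) := by
  induction is generalizing r with
  | nil => simp [pushAll]
  | cons i is ih =>
    rw [List.nodup_cons] at his
    rw [pushAll, stepAux_pushReg, ih his.2]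
    congr 2
    funext k
    by_cases h : k = i
    · subst h; simp [his.1]
    · simp [h]

/-- Move the contents of a register, in reversed order, to all registers of a list. -/
def moveFrag (tm : J → FinTM2) (i : R) (is : List R) : Frag (Alphabet tm R) (Memory tm) where
  Λ := Unit
  main := ()
  m := fun _ => popReg i (fun s o => (o, s.2))
    (.branch (fun s => s.1.isSome) (pushAll (.goto fun _ => ()) is) .halt)

/-- Two targets make a copy and an empty list of targets erases the register. The extra step is the
pop that finds the register empty. -/
theorem run_moveFrag {i : R} {is : List R} (his : is.Nodup) (hi : i ∉ is) (s : ∀ j, (tm j).σ)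
    (r : R → List Sym) (T : ∀ j k, List ((tm j).Γ k)) :
    (moveFrag tm i is).Run ((r i).length + 1) ((none, s), contents r T)
      ((none, s), contents (fun k => if k = i then [] else
        if k ∈ is then (r i).reverse ++ r k else r k) T) := by
  suffices H : ∀ (l : List Sym) (b : Option Sym) (r : R → List Sym), r i = l →
      Steps (moveFrag tm i is).m (l.length + 1) ⟨some (), (b, s), contents r T⟩
        ⟨none, (none, s), contents (fun k => if k = i then [] else
          if k ∈ is then l.reverse ++ r k else r k) T⟩ from H (r i) none r rfl
  intro l
  induction l with
  | nil =>
    intro b r hr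
    refine Steps.head ?_ (Steps.refl _)
    simp only [TM2.step, moveFrag, TM2.stepAux, hr, stepAux_popReg]
    simp only [List.head?_nil, Option.isSome_none, cond_false, List.tail_nil]
    congr
    funext k
    by_cases h : k = i
    · subst h; simp
    · simp [h]
  | cons a l ih =>
    intro b r hr
    let r' : R → List Sym := fun k => if k ∈ is then a :: r k else if k = i then l else r k
    have hr' : (fun k => if k = i then [] else if k ∈ is then l.reverse ++ r' k else r' k) =
        fun k => if k = i then [] else if k ∈ is then (a :: l).reverse ++ r k else r k := by
      funext k
      by_cases h : k = i
      · subst h; simp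
      · by_cases h' : k ∈ is <;> simp [r', h, h']
    have := ih (some a) r' (by simp [r', hi])
    rw [hr'] at this
    refine Steps.head ?_ this
    simp only [TM2.step, moveFrag, stepAux_popReg, TM2.stepAux, hr, List.head?_cons,
      Option.isSome_some, cond_true, List.tail_cons, stepAux_pushAll _ _ his]
    congr
    funext k
    by_cases h : k = i
    · subst h; simp [hi, r']
    · simp [h, r']

/-- Move the contents of a register, in reversed order, to a stack of the machine `tm j`. -/
def loadFrag (i : R) (j : J) (k : (tm j).K) (inp : Sym → (tm j).Γ k) :
    Frag (Alphabet tm R) (Memory tm) where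
  Λ := Unit
  main := ()
  m := fun _ => popReg i (fun s o => (o, s.2))
    (.branch (fun s => s.1.isSome)
      (pushOn j k (fun s => inp (s.1.getD none)) (.goto fun _ => ())) .halt)

theorem run_loadFrag (i : R) (j : J) (k : (tm j).K) (inp : Sym → (tm j).Γ k)
    (s : ∀ j, (tm j).σ) (r : R → List Sym) :
    (loadFrag i j k inp).Run ((r i).length + 1) ((none, s), contents r (noStacks tm))
      ((none, s), contents (Function.update r i [])
        (oneStack j k ((r i).reverse.map inp))) := by
  suffices H : ∀ (l : List Sym) (b : Option Sym) (r : R → List Sym) (l' : List ((tm j).Γ k)),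
      r i = l → Steps (loadFrag i j k inp).m (l.length + 1)
        ⟨some (), (b, s), contents r (oneStack j k l')⟩
        ⟨none, (none, s), contents (Function.update r i [])
          (oneStack j k (l.reverse.map inp ++ l'))⟩ by
    have := H (r i) none r [] rfl
    simp only [oneStack_nil, List.append_nil] at this
    exact this
  intro l
  induction l with
  | nil =>
    intro b r l' hr
    refine Steps.head ?_ (Steps.refl _)
    simp only [TM2.step, loadFrag, TM2.stepAux, hr, stepAux_popReg, stepAux_pushOn]
    simp
  | cons a l ih =>
    intro b r l' hr
    have := ih (some a) (Function.update r i l) (inp a :: l') (by simp)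
    simp only [Function.update_idem] at this
    simp only [List.reverse_cons, List.map_append, List.map_cons, List.map_nil,
      List.append_assoc, List.cons_append, List.nil_append]
    refine Steps.head ?_ this
    simp only [TM2.step, loadFrag, TM2.stepAux, hr, stepAux_popReg, stepAux_pushOn]
    simp [oneStack]

/-- Move the contents of a stack of the machine `tm j`, in reversed order, to a register. -/
def unloadFrag (i : R) (j : J) (k : (tm j).K) (out : (tm j).Γ k → Sym) :
    Frag (Alphabet tm R) (Memory tm) where
  Λ := Unit
  main := ()
  m := fun _ => popFrom j k (fun s o => (o.map out, s.2))
    (.branch (fun s => s.1.isSome)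
      (pushReg i (fun s => s.1.getD none) (.goto fun _ => ())) .halt)

theorem run_unloadFrag (i : R) (j : J) (k : (tm j).K) (out : (tm j).Γ k → Sym)
    (s : ∀ j, (tm j).σ) (r : R → List Sym) (l : List ((tm j).Γ k)) :
    (unloadFrag i j k out).Run (l.length + 1) ((none, s), contents r (oneStack j k l))
      ((none, s), contents (Function.update r i ((l.map out).reverse ++ r i)) (noStacks tm)) := by
  suffices H : ∀ (b : Option Sym) (r : R → List Sym),
      Steps (unloadFrag i j k out).m (l.length + 1)
        ⟨some (), (b, s), contents r (oneStack j k l)⟩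
        ⟨none, (none, s), contents (Function.update r i ((l.map out).reverse ++ r i))
          (noStacks tm)⟩ from H none r
  induction l with
  | nil =>
    intro b r
    refine Steps.head ?_ (Steps.refl _)
    simp only [TM2.step, unloadFrag, stepAux_pushReg, stepAux_popFrom, TM2.stepAux]
    rw [← oneStack_nil j k]
    simp [oneStack]
  | cons a l ih =>
    intro b r
    have := ih (some (out a)) (Function.update r i (out a :: r i))
    simp only [Function.update_idem, Function.update_self] at this
    simp only [List.map_cons, List.reverse_cons, List.append_assoc, List.cons_append,
      List.nil_append]
    refine Steps.head ?_ this
    simp only [TM2.step, unloadFrag, stepAux_pushReg, stepAux_popFrom, TM2.stepAux]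
    simp [oneStack]

end Registers

/-! ### Polynomial time register programs -/

/-- On input `l`, the machine `t` outputs `g` within the time bound `p`. -/
def Computes (t : FinTM2) (inp : Sym → t.Γ t.k₀) (out : t.Γ t.k₁ → Sym) (p : Polynomial ℕ)
    (l g : List Sym) : Prop :=
  ∃ (l' : List (t.Γ t.k₁)) (n : ℕ), l'.map out = g ∧ n ≤ p.eval l.length ∧
    Steps t.m n (initList t (l.map inp)) (haltList t l')

theorem exists_length_le_of_computes (t : FinTM2) (inp : Sym → t.Γ t.k₀)
    (out : t.Γ t.k₁ → Sym) (p : Polynomial ℕ) :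
    ∃ q : Polynomial ℕ, ∀ l g, Computes t inp out p l g → g.length ≤ q.eval l.length := by
  obtain ⟨g, hg⟩ := exists_growth t.m
  refine ⟨.X + p * .C g, ?_⟩
  rintro l _ ⟨l', n, rfl, hn, h⟩
  have h1 := hg h t.k₁
  rw [initList_eq, haltList_eq] at h1
  -- Input and output stack may coincide; otherwise the output stack starts empty.
  have h2 : (Function.update (fun k => ([] : List (t.Γ k))) t.k₀ (l.map inp) t.k₁).length ≤
      l.length := by
    by_cases hk : t.k₁ = t.k₀
    · rw [hk]; simp
    · simp [Function.update_of_ne hk]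
  have h3 : n * g ≤ p.eval l.length * g := Nat.mul_le_mul_right _ hn
  simp only [Function.update_self, List.length_map, Polynomial.eval_add, Polynomial.eval_mul,
    Polynomial.eval_X, Polynomial.eval_C] at h1 h2 ⊢
  omega

/-- The total length of the registers. -/
def size {R : Type} [Fintype R] (r : R → List Sym) : ℕ := ∑ i, (r i).length

theorem length_le_size {R : Type} [Fintype R] (r : R → List Sym) (i : R) : (r i).length ≤ size r :=
  Finset.single_le_sum (f := fun i => (r i).length) (fun _ _ => Nat.zero_le _)
    (Finset.mem_univ i)

section RPoly

variable {J : Type} [DecidableEq J] (tm : J → FinTM2) {R : Type} [DecidableEq R] [Fintype R]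
  {α β : Type}

/-- Some register program transforms the registers `pre a` into `post a` in polynomial time. -/
def RPoly (pre post : α → R → List Sym) : Prop :=
  ∃ (F : Frag (Alphabet tm R) (Memory tm)) (p : Polynomial ℕ), ∀ a,
    ∃ n ≤ p.eval (size (pre a)), F.Run n (initMemory tm, contents (pre a) (noStacks tm))
      (initMemory tm, contents (post a) (noStacks tm))

variable {tm}

theorem RPoly.exists_size_le {pre post : α → R → List Sym} (h : RPoly tm pre post) :
    ∃ q : Polynomial ℕ, ∀ a, size (post a) ≤ q.eval (size (pre a)) := by
  obtain ⟨F, p, h⟩ := h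
  obtain ⟨g, hg⟩ := exists_growth F.m
  refine ⟨.X + .C (Fintype.card R) * (p * .C g), fun a => ?_⟩
  obtain ⟨n, hn, h⟩ := h a
  have h1 : ∀ i, (post a i).length ≤ (pre a i).length + p.eval (size (pre a)) * g := fun i =>
    (hg h (.inl i)).trans (Nat.add_le_add_left (Nat.mul_le_mul_right _ hn) _)
  refine (Finset.sum_le_sum fun i _ => h1 i).trans (le_of_eq ?_)
  simp [Finset.sum_add_distrib, size]

/-- The second time bound is evaluated at the size left behind by the first program, hence the
composition with the polynomial `q` bounding that size. -/
theorem RPoly.seq {pre mid post : α → R → List Sym} (h : RPoly tm pre mid)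
    (h' : RPoly tm mid post) : RPoly tm pre post := by
  obtain ⟨q, hq⟩ := h.exists_size_le
  obtain ⟨F, p, h⟩ := h
  obtain ⟨F', p', h'⟩ := h'
  refine ⟨F.seq F', p + p'.comp q, fun a => ?_⟩
  obtain ⟨n, hn, h⟩ := h a
  obtain ⟨n', hn', h'⟩ := h' a
  refine ⟨n + n', ?_, h.seq h'⟩
  rw [Polynomial.eval_add, Polynomial.eval_comp]
  exact Nat.add_le_add hn (hn'.trans (eval_mono _ (hq a)))

theorem RPoly.of_eq {pre post post' : α → R → List Sym} (h : RPoly tm pre post)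
    (e : ∀ a i, post a i = post' a i) : RPoly tm pre post' := by
  have : post = post' := by funext a i; exact e a i
  exact this ▸ h

theorem RPoly.move (pre : α → R → List Sym) (i : R) (is : List R) (his : is.Nodup)
    (hi : i ∉ is) : RPoly tm pre fun a k =>
      if k = i then [] else if k ∈ is then (pre a i).reverse ++ pre a k else pre a k := by
  refine ⟨moveFrag tm i is, .X + 1, fun a =>
    ⟨_, ?_, run_moveFrag his hi (initMemory tm).2 (pre a) (noStacks tm)⟩⟩
  simpa using length_le_size (pre a) i

/-- Pop from register `i`, then continue with `F` or with `G`. -/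
def branchFrag (i : R) (F G : Frag (Alphabet tm R) (Memory tm)) :
    Frag (Alphabet tm R) (Memory tm) where
  Λ := Option (F.Λ ⊕ G.Λ)
  main := none
  m := fun l => match l with
    | none => popReg i (fun s o => (o, s.2))
        (.branch (fun s => s.1 == some (some true))
          (.load (fun s => (none, s.2)) (.goto fun _ => some (.inl F.main)))
          (.load (fun s => (none, s.2)) (.goto fun _ => some (.inr G.main))))
    | some (.inl l) => relabel (fun l => some (.inl l)) .halt (F.m l)
    | some (.inr l) => relabel (fun l => some (.inr l)) .halt (G.m l)

theorem RPoly.ite {pre post : α → R → List Sym} (i : R) (c : α → Bool)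
    (hc : ∀ a, pre a i = [some (c a)])
    (h₁ : RPoly tm (fun a : {a // c a = true} => Function.update (pre a) i [])
      (fun a : {a // c a = true} => post a))
    (h₂ : RPoly tm (fun a : {a // c a = false} => Function.update (pre a) i [])
      (fun a : {a // c a = false} => post a)) : RPoly tm pre post := by
  obtain ⟨F, p, hF⟩ := h₁
  obtain ⟨G, q, hG⟩ := h₂
  have hsize : ∀ a, size (Function.update (pre a) i []) ≤ size (pre a) := fun a => by
    refine Finset.sum_le_sum fun k _ => ?_
    by_cases hk : k = i
    · subst hk; simp
    · simp [hk]
  refine ⟨branchFrag i F G, p + q + 1, fun a => ?_⟩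
  cases ha : c a
  · obtain ⟨n, hn, h⟩ := hG ⟨a, ha⟩
    refine ⟨n + 1, ?_, Steps.head (c' := ⟨some (some (.inr G.main)), initMemory tm,
      contents (Function.update (pre a) i []) (noStacks tm)⟩) ?_
      (Steps.relabel (M' := (branchFrag i F G).m) (f := fun l => some (.inr l)) (h := .halt)
        (fun _ => rfl) h)⟩
    · have := hn.trans (eval_mono q (hsize a))
      simp; omega
    · simp [TM2.step, branchFrag, stepAux_popReg, hc, ha, initMemory]
  · obtain ⟨n, hn, h⟩ := hF ⟨a, ha⟩
    refine ⟨n + 1, ?_, Steps.head (c' := ⟨some (some (.inl F.main)), initMemory tm,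
      contents (Function.update (pre a) i []) (noStacks tm)⟩) ?_
      (Steps.relabel (M' := (branchFrag i F G).m) (f := fun l => some (.inl l)) (h := .halt)
        (fun _ => rfl) h)⟩
    · have := hn.trans (eval_mono p (hsize a))
      simp; omega
    · simp [TM2.step, branchFrag, stepAux_popReg, hc, ha, initMemory]

/-- Every transfer between stacks reverses the word. Passing through the scratch register `t` on the
way in and on the way out makes two reversals each time, which restores the order. -/
theorem RPoly.call {pre : α → R → List Sym} (j : J) (i t : R) (hit : i ≠ t)
    (ht : ∀ a, pre a t = []) {inp : Sym → (tm j).Γ (tm j).k₀} {out : (tm j).Γ (tm j).k₁ → Sym}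
    {p : Polynomial ℕ} {g : α → List Sym}
    (h : ∀ a, Computes (tm j) inp out p (pre a i) (g a)) :
    RPoly tm pre fun a => Function.update (pre a) i (g a) := by
  obtain ⟨q, hq⟩ := exists_length_le_of_computes (tm j) inp out p
  refine ⟨(moveFrag tm i [t]).seq <| (loadFrag t j _ inp).seq <| (runFrag R j).seq <|
    (unloadFrag t j _ out).seq (moveFrag tm t [i]),
    (.X + 1) + ((.X + 1) + (p + ((q + 1) + (q + 1)))), fun a => ?_⟩
  have hlen := hq _ _ (h a)
  obtain ⟨l', n, hl', hn, h⟩ := h a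
  have e1 : (fun k => if k = i then [] else
      if k ∈ [t] then (pre a i).reverse ++ pre a k else pre a k) =
      Function.update (Function.update (pre a) t (pre a i).reverse) i [] := by
    funext k
    by_cases hk : k = i
    · subst hk; simp
    · by_cases hk' : k = t
      · subst hk'; simp [hk, ht]
      · simp [hk, hk']
  have h1 := run_moveFrag (tm := tm) (i := i) (is := [t]) (by simp) (by simpa using hit)
    (initMemory tm).2 (pre a) (noStacks tm)
  rw [e1] at h1
  have h2 := run_loadFrag t j _ inp (initMemory tm).2
    (Function.update (Function.update (pre a) t (pre a i).reverse) i [])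
  have e2 : Function.update (Function.update (pre a) t (pre a i).reverse) i [] t =
    (pre a i).reverse := by simp [hit.symm]
  have e3 : Function.update (Function.update (Function.update (pre a) t (pre a i).reverse) i [])
      t [] = Function.update (pre a) i [] := by
    funext k
    by_cases hk : k = t
    · subst hk; simp [hit.symm, ht]
    · by_cases hk' : k = i
      · subst hk'; simp [hk]
      · simp [hk, hk']
  rw [e2, e3, List.reverse_reverse, List.length_reverse] at h2
  have h3 := run_runFrag j h (Function.update (pre a) i [])
  have h4 := run_unloadFrag t j _ out (initMemory tm).2 (Function.update (pre a) i []) l'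
  have e4 : Function.update (pre a) i [] t = [] := by simp [hit.symm, ht]
  rw [e4, List.append_nil, hl'] at h4
  have h5 := run_moveFrag (tm := tm) (i := t) (is := [i]) (by simp) (by simpa using hit.symm)
    (initMemory tm).2 (Function.update (Function.update (pre a) i []) t (g a).reverse)
    (noStacks tm)
  have e5 : (fun k => if k = t then [] else if k ∈ [i] then
      (Function.update (Function.update (pre a) i []) t (g a).reverse t).reverse ++
        Function.update (Function.update (pre a) i []) t (g a).reverse k
      else Function.update (Function.update (pre a) i []) t (g a).reverse k) =
      Function.update (pre a) i (g a) := by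
    funext k
    by_cases hk : k = t
    · subst hk; simp [hit.symm, ht]
    · by_cases hk' : k = i
      · subst hk'; simp [hit]
      · simp [hk, hk']
  rw [e5, Function.update_self, List.length_reverse] at h5
  refine ⟨_, ?_, h1.seq (h2.seq (h3.seq (h4.seq h5)))⟩
  have hsize := length_le_size (pre a) i
  have hp := hn.trans (eval_mono p hsize)
  have hq' := hlen.trans (eval_mono q hsize)
  have : l'.length = (g a).length := by rw [← hl', List.length_map]
  simp only [Polynomial.eval_add, Polynomial.eval_X, Polynomial.eval_one]
  omega

end RPoly

/-! ### Polynomial time functions on words over the register alphabet -/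

section FP

variable {α β : Type}

/-- `f` is computable in polynomial time on `D`, where the inputs are encoded by `ea`. -/
def FP (ea : α → List Sym) (D : Set α) (f : α → List Sym) : Prop :=
  ∃ (t : FinTM2) (inp : Sym → t.Γ t.k₀) (out : t.Γ t.k₁ → Sym) (p : Polynomial ℕ),
    ∀ a ∈ D, Computes t inp out p (ea a) (f a)

theorem FP.congr {ea : α → List Sym} {D E : Set α} {f g : α → List Sym} (h : FP ea D f)
    (hE : E ⊆ D) (hfg : ∀ a ∈ E, f a = g a) : FP ea E g := by
  obtain ⟨t, inp, out, p, h⟩ := h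
  exact ⟨t, inp, out, p, fun a ha => hfg a ha ▸ h a (hE ha)⟩

theorem FP.mono {ea : α → List Sym} {D E : Set α} {f : α → List Sym} (h : FP ea D f)
    (hE : E ⊆ D) : FP ea E f := h.congr hE fun _ _ => rfl

theorem FP.exists_length_le {ea : α → List Sym} {D : Set α} {f : α → List Sym}
    (h : FP ea D f) : ∃ q : Polynomial ℕ, ∀ a ∈ D, (f a).length ≤ q.eval (ea a).length := by
  obtain ⟨t, inp, out, p, h⟩ := h
  obtain ⟨q, hq⟩ := exists_length_le_of_computes t inp out p
  exact ⟨q, fun a ha => hq _ _ (h a ha)⟩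

/-- Only register `i` is nonempty. -/
def oneReg {R : Type} [DecidableEq R] (i : R) (l : List Sym) : R → List Sym :=
  Function.update (fun _ => []) i l

theorem contents_nil {J R : Type} (tm : J → FinTM2) :
    contents (fun _ : R => []) (noStacks tm) = fun _ => [] := by
  funext k
  rcases k with k | k <;> rfl

theorem contents_oneReg {J R : Type} [DecidableEq J] [DecidableEq R] (tm : J → FinTM2) (i : R)
    (l : List Sym) : contents (oneReg i l) (noStacks tm) =
      Function.update (β := fun k => List (Alphabet tm R k)) (fun _ => []) (.inl i) l := by
  rw [← contents_nil tm, update_contents_inl]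
  rfl

theorem FP.of_rpoly {J : Type} [DecidableEq J] [Fintype J] {tm : J → FinTM2} {R : Type}
    [DecidableEq R] [Fintype R] {ea : α → List Sym} {D : Set α} {f : α → List Sym} (i o : R)
    (h : RPoly tm (fun a : D => oneReg i (ea a)) (fun a : D => oneReg o (f a))) :
    FP ea D f := by
  obtain ⟨F, p, h⟩ := h
  let t : FinTM2 :=
    { K := Stack tm R
      k₀ := .inl i
      k₁ := .inl o
      Γ := Alphabet tm R
      Λ := F.Λ
      main := F.main
      σ := Memory tm
      initialState := initMemory tm
      Γk₀Fin := inferInstanceAs (Fintype Sym)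
      m := F.m }
  refine ⟨t, fun x => x, fun x => x, p, fun a ha => ?_⟩
  obtain ⟨n, hn, h⟩ := h ⟨a, ha⟩
  refine ⟨f a, n, List.map_id _, ?_, ?_⟩
  · convert hn
    simp [size, oneReg, Function.update_apply, apply_ite]
  · unfold Frag.Run at h
    rw [contents_oneReg, contents_oneReg] at h
    have hm : List.map (fun x : Sym => x) (ea a) = ea a := List.map_id _
    have h₀ := (congrArg (initList t) hm).trans (initList_eq t (ea a))
    have h₁ := haltList_eq t (f a)
    exact h₀ ▸ h₁ ▸ h

/-- The argument `b` need not be computed: it is enough that the word `f a` happens to encode some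
`b` in the domain of `g`. In this way a function with a promise on its inputs can be called. -/
theorem FP.comp {ea : α → List Sym} {eb : β → List Sym} {D : Set α} {E : Set β}
    {f h : α → List Sym} {g : β → List Sym} (hf : FP ea D f) (hg : FP eb E g)
    (H : ∀ a ∈ D, ∃ b ∈ E, eb b = f a ∧ g b = h a) : FP ea D h := by
  obtain ⟨t, inp, out, p, hf⟩ := hf
  obtain ⟨t', inp', out', p', hg⟩ := hg
  let tm : Bool → FinTM2 := fun b => match b with
    | true => t
    | false => t'
  refine FP.of_rpoly (tm := tm) (R := Bool) true true ?_
  refine ((RPoly.call (inp := inp) (out := out) (p := p) (g := fun a : D => f a) true true false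
    (by simp) (fun a => by simp [oneReg]) fun a => ?_).seq
    (RPoly.call (inp := inp') (out := out') (p := p') (g := fun a : D => h a) false true false
      (by simp) (fun a => by simp [oneReg]) fun a => ?_)).of_eq fun a i => ?_
  · simpa [oneReg] using hf a a.2
  · obtain ⟨b, hb, e, e'⟩ := H a a.2
    have := hg b hb
    simp only [Function.update_self]
    rw [← e, ← e']
    exact this
  · simp [oneReg]

/-- Each branch is required to work only where the test selects it. This is the guard in front of
machines that are correct only on descriptions or on instances. -/
theorem FP.ite {ea : α → List Sym} {D : Set α} {f : α → List Sym} {c : α → Bool}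
    (hc : FP ea D fun a => [some (c a)]) (h₁ : FP ea {a | a ∈ D ∧ c a = true} f)
    (h₂ : FP ea {a | a ∈ D ∧ c a = false} f) : FP ea D f := by
  obtain ⟨t, inp, out, p, hc⟩ := hc
  obtain ⟨t₁, inp₁, out₁, p₁, h₁⟩ := h₁
  obtain ⟨t₂, inp₂, out₂, p₂, h₂⟩ := h₂
  let tm : Option Bool → FinTM2 := fun b => match b with
    | none => t
    | some true => t₁
    | some false => t₂
  refine FP.of_rpoly (tm := tm) (R := Fin 3) 0 0 ?_
  -- The test consumes its input, so a copy is kept. The detour through register 1 undoes the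
  -- reversal.
  have s1 := RPoly.move (tm := tm) (R := Fin 3) (fun a : D => oneReg 0 (ea a)) 0 [1]
    (by simp) (by simp)
  have s2 := s1.seq (RPoly.move _ 1 [0, 2] (by simp) (by simp))
  have s3 : RPoly tm (R := Fin 3) (fun a : D => oneReg 0 (ea a))
      (fun a : D => ![ea a, [], ea a]) := s2.of_eq fun a i => by
    fin_cases i <;> simp [oneReg]
  have s4 := s3.seq (RPoly.call (inp := inp) (out := out) (p := p)
    (g := fun a : D => [some (c a)]) none 2 1 (by simp) (fun a => by simp)
    fun a => hc a a.2)
  have s5 : RPoly tm (R := Fin 3) (fun a : D => oneReg 0 (ea a))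
      (fun a : D => ![ea a, [], [some (c a)]]) := s4.of_eq fun a i => by
    fin_cases i <;> simp
  refine s5.seq (RPoly.ite 2 (fun a : D => c a) (fun a => by simp) ?_ ?_)
  · refine (RPoly.call (inp := inp₁) (out := out₁) (p := p₁)
      (g := fun a : {a : D // c a = true} => f a) (some true) 0 1 (by simp) (fun a => by simp)
      fun a => h₁ a ⟨a.1.2, a.2⟩).of_eq fun a i => ?_
    fin_cases i <;> simp [oneReg]
  · refine (RPoly.call (inp := inp₂) (out := out₂) (p := p₂)
      (g := fun a : {a : D // c a = false} => f a) (some false) 0 1 (by simp) (fun a => by simp)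
      fun a => h₂ a ⟨a.1.2, a.2⟩).of_eq fun a i => ?_
    fin_cases i <;> simp [oneReg]

end FP

/-! ### Polynomial time functions between arbitrary encodings -/

/-- Changes alphabets at both ends. The map `i` need not be injective, so a binary word may be fed
from a register over `{0, 1, #}` by sending `#` to an arbitrary bit. -/
theorem FP.of_polyTime {γ δ γΓ δΓ : Type} {eγ : γ → List γΓ} {eδ : δ → List δΓ} {g : γ → δ}
    (h : PolyHierarchy.PolyTime eγ eδ g) (i : Sym → γΓ) (o : δΓ → Sym) (ea : γ → List Sym)
    (hea : ∀ c, (ea c).map i = eγ c) : FP ea Set.univ fun c => (eδ (g c)).map o := by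
  obtain ⟨⟨⟨t, eqi, eqo⟩, p, h⟩⟩ := h
  refine ⟨t, fun x => eqi.symm (i x), fun x => o (eqo x), p, fun c _ => ?_⟩
  obtain ⟨⟨n, hn⟩, hle⟩ := h c
  refine ⟨(eδ (g c)).map eqo.symm, n, ?_, ?_, ?_⟩
  · simp
  · have : (eγ c).length = (ea c).length := by rw [← hea, List.length_map]
    exact this ▸ hle
  · have e : (ea c).map (fun x => eqi.symm (i x)) = (eγ c).map eqi.symm := by
      rw [← hea, List.map_map]; rfl
    rw [e]
    exact steps_iff_iterate.2 hn

theorem FP.id {α : Type} (ea : α → List Sym) : FP ea Set.univ ea := by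
  have h : PolyHierarchy.PolyTime ea ea fun a => a := ⟨idComputableInPolyTime ea⟩
  exact (FP.of_polyTime h (fun x => x) (fun x => x) ea fun c => List.map_id _).congr
    subset_rfl fun a _ => List.map_id _

theorem contents_oneStack {J R : Type} [DecidableEq J] [DecidableEq R] (tm : J → FinTM2) (j : J)
    (k : (tm j).K) (l : List ((tm j).Γ k)) : contents (fun _ => []) (oneStack j k l) =
      Function.update (β := fun k => List (Alphabet tm R k)) (fun _ => []) (.inr ⟨j, k⟩) l := by
  rw [← contents_nil tm, update_contents_inr]
  rfl

theorem run_loadFrag_oneReg {J R : Type} [DecidableEq J] [DecidableEq R] {tm : J → FinTM2}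
    (i : R) (j : J) (k : (tm j).K) (inp : Sym → (tm j).Γ k) (l : List Sym) :
    (loadFrag i j k inp).Run (l.length + 1)
      (initMemory tm, contents (oneReg i l) (noStacks tm))
      (initMemory tm, contents (fun _ => []) (oneStack j k (l.reverse.map inp))) := by
  have h := run_loadFrag i j k inp (initMemory tm).2 (oneReg i l)
  have e : Function.update (oneReg i l) i [] = fun _ => [] := by
    rw [oneReg, Function.update_idem]
    exact Function.update_eq_self i (fun _ => [])
  have e' : oneReg i l i = l := Function.update_self ..
  rw [e, e'] at h
  exact h

/-- The output alphabet must be equivalent to `Bool`, whereas registers also hold `#`. The identity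
machine on `Bool` is included but never run; it only supplies a stack with the right alphabet, onto
which the answer is moved in two steps. -/
theorem FP.polyTime_bool {α : Type} {ea : α → List Sym} {b : α → Bool}
    (h : FP ea Set.univ fun a => [some (b a)]) :
    PolyHierarchy.PolyTime ea Computability.encodeBool b := by
  obtain ⟨t, inp, out, p, h⟩ := h
  let tm : Bool → FinTM2 := fun b => match b with
    | true => t
    | false => idComputer Bool
  have hcall : RPoly tm (R := Bool) (fun a => oneReg true (ea a))
      (fun a => oneReg true [some (b a)]) :=
    (RPoly.call (inp := inp) (out := out) (p := p) (g := fun a => [some (b a)]) true true false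
      (by simp) (fun a => by simp [oneReg]) (fun a => by simpa [oneReg] using h a trivial)).of_eq
      fun a i => by simp [oneReg]
  obtain ⟨F, q, hF⟩ := hcall
  let G : Frag (Alphabet tm Bool) (Memory tm) :=
    F.seq (loadFrag true false () fun x => x.getD false)
  let t' : FinTM2 :=
    { K := Stack tm Bool
      k₀ := .inl true
      k₁ := .inr ⟨false, ()⟩
      Γ := Alphabet tm Bool
      Λ := G.Λ
      main := G.main
      σ := Memory tm
      initialState := initMemory tm
      Γk₀Fin := inferInstanceAs (Fintype Sym)
      m := G.m }
  have key : ∀ a, ∃ n ≤ (q + 2).eval (ea a).length, Steps t'.m n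
      (initList t' ((ea a).map fun x : Sym => x)) (haltList t' [b a]) := by
    intro a
    obtain ⟨n, hn, h⟩ := hF a
    have h2 : (loadFrag true false () fun x => x.getD false).Run 2
        (initMemory tm, contents (oneReg true [some (b a)]) (noStacks tm))
        (initMemory tm, contents (fun _ => []) (oneStack false () [b a])) :=
      run_loadFrag_oneReg (tm := tm) true false () (fun x => x.getD false) [some (b a)]
    refine ⟨n + 2, ?_, ?_⟩
    · have : size (oneReg true (ea a)) = (ea a).length := by
        simp [size, oneReg]
      simp only [this] at hn
      simpa using hn
    · have hm : List.map (fun x : Sym => x) (ea a) = ea a := List.map_id _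
      have h₀ := ((congrArg (initList t') hm).trans (initList_eq t' (ea a))).trans
        (congrArg (TM2.Cfg.mk _ _) (contents_oneReg tm true (ea a)).symm)
      have h₁ := (haltList_eq t' [b a]).trans
        (congrArg (TM2.Cfg.mk _ _) (contents_oneStack (R := Bool) tm false () [b a]).symm)
      exact h₀ ▸ h₁ ▸ h.seq h2
  choose n hn hs using key
  exact ⟨⟨⟨t', Equiv.refl Sym, Equiv.refl Bool⟩, q + 2,
    fun a => ⟨⟨n a, steps_iff_iterate.1 (hs a)⟩, hn a⟩⟩⟩

/-! ### Multitape transducers -/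

/-- A deterministic transducer that reads several tapes, each from left to right. In state `q` it
reads the tape `tape q` (and halts if there is none), writes `emit q` and goes to `next q`. -/
structure Transducer (J : Type) where
  /-- the states -/
  Q : Type
  /-- there are finitely many states -/
  [fin : Fintype Q]
  /-- the initial state -/
  start : Q
  /-- the tape that is read -/
  tape : Q → Option J
  /-- the next state, given the symbol that was read -/
  next : Q → Option Sym → Q
  /-- the output, given the symbol that was read -/
  emit : Q → Option Sym → Option Sym

attribute [instance] Transducer.fin

namespace Transducer

variable {J : Type} [DecidableEq J]

/-- `M.Out q τ w n`: from state `q` with tapes `τ`, the transducer outputs `w` in `n` steps. -/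
inductive Out (M : Transducer J) : M.Q → (J → List Sym) → List Sym → ℕ → Prop
  | halt {q τ} : M.tape q = none → Out M q τ [] 0
  | step {q τ w n} (j : J) : M.tape q = some j →
      Out M (M.next q (τ j).head?) (Function.update τ j (τ j).tail) w n →
      Out M q τ ((M.emit q (τ j).head?).toList ++ w) (n + 1)

variable {I : Type} [DecidableEq I] (tm : I → FinTM2) {R : Type} [DecidableEq R]

/-- The transducer as a register program. -/
def frag (M : Transducer J) (e : J → R) (o : R) : Frag (Alphabet tm R) (Memory tm) where
  Λ := M.Q
  main := M.start
  m := fun q => match M.tape q with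
    | none => .load (fun s => (none, s.2)) .halt
    | some j => popReg (e j) (fun s x => (x, s.2))
        (.branch (fun s => (M.emit q s.1).isSome)
          (pushReg o (fun s => (M.emit q s.1).getD none) (.goto fun s => M.next q s.1))
          (.goto fun s => M.next q s.1))

/-- The added step executes the final `halt`. What remains on the tapes is left unspecified, since
the transducer may stop before reading them to the end. -/
theorem Out.run {M : Transducer J} {e : J → R} (he : Function.Injective e) {o : R}
    (ho : ∀ j, e j ≠ o) {q : M.Q} {τ : J → List Sym} {w : List Sym} {n : ℕ}
    (h : M.Out q τ w n) (b : Option Sym) (s : ∀ j, (tm j).σ) (r : R → List Sym)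
    (hr : ∀ j, r (e j) = τ j) : ∃ r' : R → List Sym,
      Steps (M.frag tm e o).m (n + 1) ⟨some q, (b, s), contents r (noStacks tm)⟩
        ⟨none, (none, s), contents r' (noStacks tm)⟩ ∧
      r' o = w.reverse ++ r o ∧ ∀ k, k ≠ o → (∀ j, k ≠ e j) → r' k = r k := by
  induction h generalizing b r with
  | halt hq =>
    refine ⟨r, Steps.head ?_ (Steps.refl _), by simp, fun _ _ _ => rfl⟩
    simp only [TM2.step, frag, hq, TM2.stepAux]
  | @step q τ w n j hq _ ih =>
    have hr₁ : ∀ j', Function.update r (e j) (τ j).tail (e j') =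
        Function.update τ j (τ j).tail j' := by
      intro j'
      by_cases hj : j' = j
      · subst hj; simp
      · have : e j' ≠ e j := fun h => hj (he h)
        simp [hj, this, hr]
    cases hem : M.emit q (τ j).head? with
    | none =>
      obtain ⟨r', h1, h2, h3⟩ := ih (τ j).head? (Function.update r (e j) (τ j).tail) hr₁
      refine ⟨r', Steps.head ?_ h1, ?_, ?_⟩
      · simp only [TM2.step, frag, hq, stepAux_popReg, TM2.stepAux, hr, hem,
          Option.isSome_none, cond_false]
      · rw [h2]; simp [(ho j).symm]
      · intro k hk hk'
        rw [h3 k hk hk', Function.update_of_ne (hk' j)]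
    | some x =>
      obtain ⟨r', h1, h2, h3⟩ := ih (τ j).head?
        (Function.update (Function.update r (e j) (τ j).tail) o (x :: r o)) (fun j' => by
          rw [Function.update_of_ne (ho j'), hr₁])
      refine ⟨r', Steps.head ?_ h1, ?_, ?_⟩
      · simp only [TM2.step, frag, hq, stepAux_popReg, stepAux_pushReg, TM2.stepAux, hr, hem,
          Option.isSome_some, cond_true, Option.getD_some, Function.update_of_ne (ho j).symm]
      · rw [h2]; simp
      · intro k hk hk'
        rw [h3 k hk hk', Function.update_of_ne hk, Function.update_of_ne (hk' j)]

end Transducer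

theorem FP.transduce {α J : Type} [DecidableEq J] [Fintype J] (M : Transducer J)
    {ea : α → List Sym} {D : Set α} {f : J → α → List Sym} {g : α → List Sym}
    (hf : ∀ j, FP ea D (f j)) (p : Polynomial ℕ)
    (h : ∀ a ∈ D, ∃ n ≤ p.eval (∑ j, (f j a).length),
      M.Out M.start (fun j => f j a) (g a) n) : FP ea D g := by
  choose tm inp out q hf using hf
  refine FP.of_rpoly (tm := tm) (R := J ⊕ Fin 3) (.inr 0) (.inr 1) ?_
  have s1 := RPoly.move (tm := tm) (R := J ⊕ Fin 3) (fun a : D => oneReg (.inr 0) (ea a))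
    (.inr 0) [.inr 1] (by simp) (by simp)
  have s2 := s1.seq (RPoly.move _ (.inr 1) (Finset.univ.toList.map .inl)
    (List.Nodup.map Sum.inl_injective (Finset.nodup_toList _)) (by simp))
  -- Each tape register holds a copy of the input; these copies are replaced by the values `f j a`
  -- one at a time.
  have s3 : ∀ js : List J, js.Nodup →
      RPoly tm (R := J ⊕ Fin 3) (fun a : D => oneReg (.inr 0) (ea a))
        (fun a : D => Sum.elim (fun j => if j ∈ js then f j a else ea a) fun _ => []) := by
    intro js
    induction js with
    | nil =>
      intro _
      refine s2.of_eq fun a k => ?_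
      rcases k with j | k
      · simp [oneReg]
      · fin_cases k <;> simp [oneReg]
    | cons j js ih =>
      intro hjs
      rw [List.nodup_cons] at hjs
      refine ((ih hjs.2).seq (RPoly.call (inp := inp j) (out := out j) (p := q j)
        (g := fun a : D => f j a) j (.inl j) (.inr 0) (by simp) (fun a => by simp)
        fun a => ?_)).of_eq fun a k => ?_
      · simpa [hjs.1] using hf j a a.2
      · rcases k with j' | k
        · by_cases hj : j' = j
          · subst hj; simp
          · simp [hj]
        · simp
  have s4 : RPoly tm (R := J ⊕ Fin 3) (fun a : D => oneReg (.inr 0) (ea a))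
      (fun a : D => Sum.elim (fun j => f j a) fun _ => []) :=
    (s3 _ (Finset.nodup_toList Finset.univ)).of_eq fun a k => by
      rcases k with j | k <;> simp
  have key : ∀ a : D, ∃ (r : J ⊕ Fin 3 → List Sym),
      (∃ n ≤ (p + 1).eval (∑ j, (f j a).length), (M.frag tm Sum.inl (.inr 2)).Run n
        (initMemory tm, contents (Sum.elim (fun j => f j a) fun _ : Fin 3 => []) (noStacks tm))
        (initMemory tm, contents r (noStacks tm))) ∧
      r (.inr 0) = [] ∧ r (.inr 1) = [] ∧ r (.inr 2) = (g a).reverse := by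
    intro a
    obtain ⟨n, hn, hout⟩ := h a a.2
    obtain ⟨r, h1, h2, h3⟩ := hout.run tm (R := J ⊕ Fin 3) Sum.inl_injective (o := .inr 2)
      (by simp) none (initMemory tm).2 (Sum.elim (fun j => f j a) fun _ => []) (by simp)
    refine ⟨r, ⟨n + 1, by simpa using hn, h1⟩, ?_, ?_, ?_⟩
    · rw [h3 _ (by simp) (by simp)]; rfl
    · rw [h3 _ (by simp) (by simp)]; rfl
    · rw [h2]; simp
  choose r hr hr0 hr1 hr2 using key
  have s5 : RPoly tm (R := J ⊕ Fin 3) (fun a : D => oneReg (.inr 0) (ea a)) r :=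
    s4.seq ⟨_, p + 1, fun a => by
      have : size (Sum.elim (fun j => f j a) fun _ : Fin 3 => []) = ∑ j, (f j a).length := by
        simp [size]
      rw [this]
      exact hr a⟩
  -- Unread remainders of the tapes are erased one register at a time.
  have s6 : ∀ js : List J, RPoly tm (R := J ⊕ Fin 3) (fun a : D => oneReg (.inr 0) (ea a))
      (fun a : D => Sum.elim (fun j => if j ∈ js then [] else r a (.inl j))
        fun k => r a (.inr k)) := by
    intro js
    induction js with
    | nil =>
      refine s5.of_eq fun a k => ?_
      rcases k with j | k <;> simp
    | cons j js ih =>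
      refine (ih.seq (RPoly.move _ (.inl j) [] (by simp) (by simp))).of_eq fun a k => ?_
      rcases k with j' | k
      · by_cases hj : j' = j
        · subst hj; simp
        · simp [hj]
      · simp
  refine ((s6 Finset.univ.toList).seq (RPoly.move _ (.inr 2) [.inr 1] (by simp)
    (by simp))).of_eq fun a k => ?_
  rcases k with j | k
  · simp [oneReg]
  · fin_cases k <;> simp [oneReg, hr0, hr1, hr2]

open PolyHierarchy

/-! ### Some transducers -/

namespace Transducer

variable {J : Type} [DecidableEq J] {M : Transducer J}

/-- From state `q` with tapes `τ`, the transducer outputs `w` in at most `b` steps. -/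
def OutLE (M : Transducer J) (q : M.Q) (τ : J → List Sym) (w : List Sym) (b : ℕ) : Prop :=
  ∃ n ≤ b, M.Out q τ w n

theorem OutLE.mono {q : M.Q} {τ : J → List Sym} {w : List Sym} {b b' : ℕ}
    (h : M.OutLE q τ w b) (hb : b ≤ b') : M.OutLE q τ w b' :=
  let ⟨n, hn, h⟩ := h
  ⟨n, hn.trans hb, h⟩

theorem OutLE.halt {q : M.Q} {τ : J → List Sym} (h : M.tape q = none) (b : ℕ) :
    M.OutLE q τ [] b := ⟨0, Nat.zero_le _, .halt h⟩

theorem OutLE.read {q q' : M.Q} {τ : J → List Sym} {w : List Sym} {b : ℕ} (j : J) {x : Sym}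
    {l : List Sym} {e : Option Sym} (hj : M.tape q = some j) (hτ : τ j = x :: l)
    (hn : M.next q (some x) = q') (he : M.emit q (some x) = e)
    (h : M.OutLE q' (Function.update τ j l) w b) : M.OutLE q τ (e.toList ++ w) (b + 1) := by
  obtain ⟨n, hb, h⟩ := h
  have := Out.step (M := M) (q := q) (τ := τ) (w := w) (n := n) j hj
  simp only [hτ, List.head?_cons, List.tail_cons, hn, he] at this
  exact ⟨n + 1, Nat.succ_le_succ hb, this h⟩

theorem OutLE.read_end {q q' : M.Q} {τ : J → List Sym} {w : List Sym} {b : ℕ} (j : J)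
    {e : Option Sym} (hj : M.tape q = some j) (hτ : τ j = [])
    (hn : M.next q none = q') (he : M.emit q none = e)
    (h : M.OutLE q' τ w b) : M.OutLE q τ (e.toList ++ w) (b + 1) := by
  obtain ⟨n, hb, h⟩ := h
  have := Out.step (M := M) (q := q) (τ := τ) (w := w) (n := n) j hj
  have hup : Function.update τ j [] = τ := by rw [← hτ, Function.update_eq_self]
  simp only [hτ, List.head?_nil, List.tail_nil, hn, he, hup] at this
  exact ⟨n + 1, Nat.succ_le_succ hb, this h⟩

/-- Copies the first component of a tuple. -/
def first : Transducer Unit where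
  Q := Bool
  start := true
  tape := fun q => if q then some () else none
  next := fun _ x => match x with
    | some (some _) => true
    | _ => false
  emit := fun _ x => match x with
    | some (some b) => some (some b)
    | _ => none

theorem first_out (u : Word) (l : List Sym) (τ : Unit → List Sym)
    (hτ : τ () = u.map some ++ none :: l) :
    first.OutLE true τ (u.map some) (u.length + 1) := by
  induction u generalizing τ with
  | nil => exact OutLE.read () rfl hτ rfl rfl (OutLE.halt rfl _)
  | cons b u ih => exact OutLE.read () rfl hτ rfl rfl (ih _ (by simp))

/-- Removes the first component of a tuple. -/
def rest : Transducer Unit where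
  Q := Option Bool
  start := some false
  tape := fun q => if q.isSome then some () else none
  next := fun q x => match q, x with
    | some false, some (some _) => some false
    | some false, some none => some true
    | some true, some _ => some true
    | _, _ => none
  emit := fun q x => match q, x with
    | some true, x => x
    | _, _ => none

theorem rest_out_copy (l : List Sym) (τ : Unit → List Sym) (hτ : τ () = l) :
    rest.OutLE (some true) τ l (l.length + 1) := by
  induction l generalizing τ with
  | nil => exact OutLE.read_end () rfl hτ rfl rfl (OutLE.halt rfl _)
  | cons b u ih => exact OutLE.read () rfl hτ rfl rfl (ih _ (by simp))

theorem rest_out (u : Word) (l : List Sym) (τ : Unit → List Sym)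
    (hτ : τ () = u.map some ++ none :: l) :
    rest.OutLE (some false) τ l (u.length + l.length + 2) := by
  induction u generalizing τ with
  | nil =>
    exact (OutLE.read () rfl hτ rfl rfl (rest_out_copy l _ (by simp))).mono (by simp)
  | cons b u ih =>
    exact (OutLE.read () rfl hτ rfl rfl (ih _ (by simp))).mono (by simp only [List.length_cons]; omega)

end Transducer

/-- The word over `{0, 1, #}` that is encoded by a binary word: `1b` stands for `b` and `0` for
the end marker; a final end marker is added. -/
def unpack : Word → List Sym
  | [] => [none]
  | false :: u => none :: unpack u
  | [true] => [none]
  | true :: b :: u => some b :: unpack u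

namespace Transducer

/-- Computes `unpack`. -/
def unpacker : Transducer Unit where
  Q := Option Bool
  start := some false
  tape := fun q => if q.isSome then some () else none
  next := fun q x => match q, x with
    | some false, some (some true) => some true
    | some false, some (some false) => some false
    | some true, some _ => some false
    | _, _ => none
  emit := fun q x => match q, x with
    | some false, some (some true) => none
    | some false, _ => some none
    | some true, some b => some b
    | some true, none => some none
    | _, _ => none

theorem unpacker_out (u : Word) (τ : Unit → List Sym) (hτ : τ () = u.map some) :
    unpacker.OutLE (some false) τ (unpack u) (u.length + 1) := by
  induction u using unpack.induct generalizing τ with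
  | case1 => exact OutLE.read_end () rfl hτ rfl rfl (OutLE.halt rfl _)
  | case2 u ih => exact OutLE.read () rfl hτ rfl rfl (ih _ (by simp))
  | case3 =>
    exact OutLE.read () rfl hτ rfl rfl
      (OutLE.read_end (w := []) (b := 0) () rfl (by simp) rfl rfl (OutLE.halt rfl _))
  | case4 b u ih =>
    exact OutLE.read () rfl hτ rfl rfl
      (OutLE.read () rfl (Function.update_self ..) rfl rfl (ih _ (by simp)))

/-- Joins two tapes with an end marker between them. -/
def joiner : Transducer Bool where
  Q := Option Bool
  start := some true
  tape := fun q => q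
  next := fun q x => match q, x with
    | some true, some _ => some true
    | some true, none => some false
    | some false, some _ => some false
    | _, _ => none
  emit := fun q x => match q, x with
    | some true, some x => some x
    | some true, none => some none
    | some false, x => x
    | _, _ => none

theorem joiner_out_snd (l : List Sym) (τ : Bool → List Sym) (hτ : τ false = l) :
    joiner.OutLE (some false) τ l (l.length + 1) := by
  induction l generalizing τ with
  | nil => exact OutLE.read_end false rfl hτ rfl rfl (OutLE.halt rfl _)
  | cons b u ih => exact OutLE.read false rfl hτ rfl rfl (ih _ (by simp))

theorem joiner_out (l l' : List Sym) (τ : Bool → List Sym) (hτ : τ true = l)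
    (hτ' : τ false = l') :
    joiner.OutLE (some true) τ (l ++ none :: l') (l.length + l'.length + 2) := by
  induction l generalizing τ with
  | nil =>
    exact (OutLE.read_end true rfl hτ rfl rfl (joiner_out_snd l' _ hτ')).mono (by simp)
  | cons b u ih =>
    exact (OutLE.read true rfl hτ rfl rfl (ih _ (by simp) (by simpa using hτ'))).mono
      (by simp only [List.length_cons]; omega)

end Transducer

/-- The components of a list at which a mask is true. -/
def select : Word → List Word → List Word
  | true :: m, x :: xs => x :: select m xs
  | false :: m, _ :: xs => select m xs
  | _, _ => []

namespace Transducer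

/-- Computes `select`. -/
def selector : Transducer Bool where
  Q := Option (Option Bool)
  start := some none
  tape := fun q => q.map Option.isNone
  next := fun q x => match q, x with
    | some none, some (some b) => some (some b)
    | some (some b), some (some _) => some (some b)
    | some (some _), some none => some none
    | _, _ => none
  emit := fun q x => match q, x with
    | some (some true), x => x
    | _, _ => none

/-- `H` is the continuation: the behaviour after the end marker of the current component, for all
tapes in that position. -/
theorem selector_out_component (b : Bool) (u : Word) (l l' w : List Sym) (n : ℕ)
    (H : ∀ τ : Bool → List Sym, τ false = l → τ true = l' → selector.OutLE (some none) τ w n)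
    (τ : Bool → List Sym) (hτ : τ false = u.map some ++ none :: l) (hτ' : τ true = l') :
    selector.OutLE (some (some b)) τ ((if b then u.map some ++ [none] else []) ++ w)
      (u.length + n + 1) := by
  induction u generalizing τ with
  | nil =>
    have h := H (Function.update τ false l) (by simp) (by simpa using hτ')
    cases b
    · exact (OutLE.read false rfl hτ rfl rfl h).mono (by simp)
    · exact (OutLE.read false rfl hτ rfl rfl h).mono (by simp)
  | cons c u ih =>
    have h := ih (Function.update τ false (u.map some ++ none :: l)) (by simp) (by simpa using hτ')
    cases b
    · exact (OutLE.read false rfl hτ rfl rfl h).mono (by simp only [List.length_cons]; omega)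
    · exact (OutLE.read false rfl hτ rfl rfl h).mono (by simp only [List.length_cons]; omega)

theorem selector_out (m : Word) (xs : List Word) (τ : Bool → List Sym)
    (hτ : τ true = m.map some) (hτ' : τ false = encodeTuple xs) :
    selector.OutLE (some none) τ (encodeTuple (select m xs))
      ((encodeTuple xs).length + m.length + 2) := by
  induction xs generalizing m τ with
  | nil =>
    have hs : select m [] = [] := by cases m <;> simp [select]
    rw [hs]
    cases m with
    | nil => exact (OutLE.read_end (b := 0) true rfl hτ rfl rfl (OutLE.halt rfl _)).mono (by simp)
    | cons b m =>
      -- The mask is longer than the list. One mask bit has been consumed before the list proves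
      -- empty; the transducer then halts silently, as `select` prescribes.
      have h : selector.OutLE (some (some b)) (Function.update τ true (m.map some)) [] 1 := by
        have hf : Function.update τ true (m.map some) false = [] := by
          simpa [encodeTuple] using hτ'
        cases b
        · exact OutLE.read_end (b := 0) false rfl hf rfl rfl (OutLE.halt rfl _)
        · exact OutLE.read_end (b := 0) false rfl hf rfl rfl (OutLE.halt rfl _)
      exact (OutLE.read true rfl hτ rfl rfl h).mono (by simp)
  | cons x xs ih =>
    cases m with
    | nil => exact (OutLE.read_end (b := 0) true rfl hτ rfl rfl (OutLE.halt rfl _)).mono (by simp)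
    | cons b m =>
      have h := selector_out_component b x (encodeTuple xs) (m.map some)
        (encodeTuple (select m xs)) _ (fun τ h₁ h₂ => ih m τ h₂ h₁)
        (Function.update τ true (m.map some)) (by simpa [encodeTuple] using hτ') (by simp)
      have hs : encodeTuple (select (b :: m) (x :: xs)) =
          (if b then x.map some ++ [none] else []) ++ encodeTuple (select m xs) := by
        cases b <;> simp [select, encodeTuple]
      rw [hs]
      refine (OutLE.read true rfl hτ rfl rfl h).mono ?_
      simp only [encodeTuple, List.flatMap_cons, List.length_append, List.length_map,
        List.length_cons, List.length_nil]
      omega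

/-- Tests two tapes for equality. -/
def comparer : Transducer Bool where
  Q := Option (Option (Option Sym))
  start := some none
  tape := fun q => q.map Option.isNone
  next := fun q x => match q with
    | some none => some (some x)
    | some (some y) => if y = x ∧ x.isSome then some none else none
    | none => none
  emit := fun q x => match q with
    | some (some y) => if y = x then if x.isSome then none else some (some true)
      else some (some false)
    | _ => none

theorem comparer_out (l l' : List Sym) (τ : Bool → List Sym) (hτ : τ true = l)
    (hτ' : τ false = l') :
    comparer.OutLE (some none) τ [some (decide (l = l'))] (2 * l.length + 2) := by
  induction l generalizing l' τ with
  | nil =>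
    cases l' with
    | nil =>
      exact OutLE.read_end true rfl hτ rfl rfl
        (OutLE.read_end (b := 0) false rfl hτ' rfl rfl (OutLE.halt rfl _))
    | cons y l' =>
      exact OutLE.read_end true rfl hτ rfl rfl
        (OutLE.read (b := 0) false rfl hτ' rfl rfl (OutLE.halt rfl _))
  | cons x l ih =>
    cases l' with
    | nil =>
      exact (OutLE.read (e := none) true rfl hτ rfl rfl
        (OutLE.read_end (b := 0) (e := some (some false)) false rfl (by simpa using hτ') rfl
          rfl (OutLE.halt rfl _))).mono (by omega)
    | cons y l' =>
      by_cases hxy : x = y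
      · subst hxy
        have h := ih l' (Function.update (Function.update τ true l) false l') (by simp) (by simp)
        have e : decide (x :: l = x :: l') = decide (l = l') := by simp
        rw [e]
        exact OutLE.read (e := none) true rfl hτ rfl rfl
          (OutLE.read (e := none) false rfl (by simpa using hτ') (by simp [comparer])
            (by simp [comparer]) h)
      · have e : decide (x :: l = y :: l') = false := by simp [hxy]
        rw [e]
        exact (OutLE.read (e := none) true rfl hτ rfl rfl
          (OutLE.read (b := 0) (e := some (some false)) (q' := none) (w := []) false rfl
            (by simpa using hτ') (by simp [comparer, hxy]) (by simp [comparer, hxy])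
            (OutLE.halt rfl _))).mono (by omega)

end Transducer

/-- Whether `g` holds for some triple of bits at the same position of three words; the positions
are those of the first word, and missing bits are false. -/
def anyTriple (g : Bool → Bool → Bool → Bool) : Word → Word → Word → Bool
  | [], _, _ => false
  | p :: ps, ss, ts => g p (ss.headD false) (ts.headD false) || anyTriple g ps ss.tail ts.tail

namespace Transducer

/-- Computes `anyTriple g`. -/
def tripleTester (g : Bool → Bool → Bool → Bool) : Transducer (Fin 3) where
  Q := Option (Option (Bool × Option Bool))
  start := some none
  tape := fun q => match q with
    | none => none
    | some none => some 0
    | some (some (_, none)) => some 1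
    | some (some (_, some _)) => some 2
  next := fun q x => match q with
    | none => none
    | some none => x.map fun y => some (y.getD false, none)
    | some (some (a, none)) => some (some (a, some ((x.getD none).getD false)))
    | some (some (a, some b)) => if g a b ((x.getD none).getD false) then none else some none
  emit := fun q x => match q with
    | some none => if x.isSome then none else some (some false)
    | some (some (a, some b)) =>
      if g a b ((x.getD none).getD false) then some (some true) else none
    | _ => none

/-- At the end of a tape the head is absent and the tail is again empty. A word that is too short
can therefore be handled together with the others, as if padded. -/
theorem OutLE.read_bit {J : Type} [DecidableEq J] {M : Transducer J} {q q' : M.Q}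
    {τ : J → List Sym} {w : List Sym} {b : ℕ} (j : J) {u : Word} {e : Option Sym}
    (hj : M.tape q = some j) (hτ : τ j = u.map some)
    (hn : M.next q (u.head?.map some) = q') (he : M.emit q (u.head?.map some) = e)
    (h : M.OutLE q' (Function.update τ j (u.tail.map some)) w b) :
    M.OutLE q τ (e.toList ++ w) (b + 1) := by
  cases u with
  | nil =>
    have : Function.update τ j (([] : Word).tail.map some) = τ := by
      have : τ j = ([] : Word).tail.map some := by simpa using hτ
      rw [← this, Function.update_eq_self]
    exact OutLE.read_end j hj hτ hn he (this ▸ h)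
  | cons c u => exact OutLE.read j hj hτ hn he h

theorem tripleTester_out (g : Bool → Bool → Bool → Bool) (p s t : Word) (τ : Fin 3 → List Sym)
    (h₀ : τ 0 = p.map some) (h₁ : τ 1 = s.map some) (h₂ : τ 2 = t.map some) :
    (tripleTester g).OutLE (some none) τ [some (anyTriple g p s t)] (3 * p.length + 1) := by
  have hd : ∀ u : Word, ((u.head?.map some).getD none).getD false = u.headD false := by
    intro u
    cases u <;> rfl
  induction p generalizing s t τ with
  | nil => exact OutLE.read_end (b := 0) 0 rfl h₀ rfl rfl (OutLE.halt rfl _)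
  | cons a p ih =>
    cases hg : g a (s.headD false) (t.headD false)
    · have h := ih s.tail t.tail (Function.update (Function.update (Function.update τ 0
        (p.map some)) 1 (s.tail.map some)) 2 (t.tail.map some)) (by simp) (by simp) (by simp)
      have e : anyTriple g (a :: p) s t = anyTriple g p s.tail t.tail := by
        rw [anyTriple, hg, Bool.false_or]
      rw [e]
      exact OutLE.read (e := none) (q' := some (some (a, none))) 0 rfl h₀ rfl rfl
        (OutLE.read_bit (e := none) (u := s) (q' := some (some (a, some (s.headD false)))) 1 rfl
          (by simpa using h₁) (by simp only [tripleTester, hd]) rfl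
        (OutLE.read_bit (e := none) (u := t) 2 rfl (by simpa using h₂)
          (by simpa [tripleTester, hd] using hg) (by simpa [tripleTester, hd] using hg) h))
    · have e : anyTriple g (a :: p) s t = true := by rw [anyTriple, hg, Bool.true_or]
      rw [e]
      exact (OutLE.read (e := none) (q' := some (some (a, none))) 0 rfl h₀ rfl rfl
        (OutLE.read_bit (e := none) (u := s) (q' := some (some (a, some (s.headD false)))) 1 rfl
          (by simpa using h₁) (by simp only [tripleTester, hd]) rfl
        (OutLE.read_bit (e := some (some true)) (u := t) (q' := none) (w := []) (b := 0) 2 rfl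
          (by simpa using h₂) (by simpa [tripleTester, hd] using hg)
          (by simpa [tripleTester, hd] using hg) (OutLE.halt rfl _)))).mono
            (by simp only [List.length_cons]; omega)

end Transducer

/-! ### Closure properties of polynomial time functions -/

section Closure

variable {α : Type} {ea : α → List Sym} {D : Set α}

theorem FP.first {u : α → Word} {us : α → List Word}
    (h : FP ea D fun a => encodeTuple (u a :: us a)) : FP ea D fun a => (u a).map some := by
  refine FP.transduce Transducer.first (f := fun _ => _) (fun _ => h) (.X + 1) fun a _ => ?_
  refine (Transducer.first_out (u a) (encodeTuple (us a)) _ (by simp [encodeTuple])).mono ?_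
  simp [encodeTuple]

theorem FP.rest {u : α → Word} {us : α → List Word}
    (h : FP ea D fun a => encodeTuple (u a :: us a)) : FP ea D fun a => encodeTuple (us a) := by
  refine FP.transduce Transducer.rest (f := fun _ => _) (fun _ => h) (.X + 1) fun a _ => ?_
  refine (Transducer.rest_out (u a) (encodeTuple (us a)) _ (by simp [encodeTuple])).mono ?_
  simp [encodeTuple]

theorem FP.unpack {u : α → Word} (h : FP ea D fun a => (u a).map some) :
    FP ea D fun a => unpack (u a) := by
  refine FP.transduce Transducer.unpacker (f := fun _ => _) (fun _ => h) (.X + 1) fun a _ => ?_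
  exact (Transducer.unpacker_out (u a) _ rfl).mono (by simp)

theorem FP.join {f g : α → List Sym} (hf : FP ea D f) (hg : FP ea D g) :
    FP ea D fun a => f a ++ none :: g a := by
  refine FP.transduce Transducer.joiner (f := fun b => if b then f else g)
    (fun b => by cases b <;> assumption) (.X + 2) fun a _ => ?_
  exact (Transducer.joiner_out (f a) (g a) _ rfl rfl).mono (by simp)

theorem FP.select {m : α → Word} {xs : α → List Word} (hm : FP ea D fun a => (m a).map some)
    (hx : FP ea D fun a => encodeTuple (xs a)) :
    FP ea D fun a => encodeTuple (select (m a) (xs a)) := by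
  refine FP.transduce Transducer.selector
    (f := fun b => if b then fun a => (m a).map some else fun a => encodeTuple (xs a))
    (fun b => by cases b <;> assumption) (.X + 2) fun a _ => ?_
  refine (Transducer.selector_out (m a) (xs a) _ rfl rfl).mono ?_
  simp
  omega

theorem FP.decide_eq {f g : α → List Sym} (hf : FP ea D f) (hg : FP ea D g) :
    FP ea D fun a => [some (decide (f a = g a))] := by
  refine FP.transduce Transducer.comparer (f := fun b => if b then f else g)
    (fun b => by cases b <;> assumption) (2 * .X + 2) fun a _ => ?_
  exact (Transducer.comparer_out (f a) (g a) _ rfl rfl).mono (by simp)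

theorem FP.anyTriple (g : Bool → Bool → Bool → Bool) {p s t : α → Word}
    (hp : FP ea D fun a => (p a).map some) (hs : FP ea D fun a => (s a).map some)
    (ht : FP ea D fun a => (t a).map some) :
    FP ea D fun a => [some (anyTriple g (p a) (s a) (t a))] := by
  refine FP.transduce (Transducer.tripleTester g)
    (f := ![fun a => (p a).map some, fun a => (s a).map some, fun a => (t a).map some])
    (fun j => by fin_cases j <;> assumption) (3 * .X + 1) fun a _ => ?_
  refine (Transducer.tripleTester_out g (p a) (s a) (t a) _ rfl rfl rfl).mono ?_
  simp [Fin.sum_univ_three]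
  omega

/-- A Boolean connective is `anyTriple` on words of length one. All arguments are evaluated, so each
has to be computable on the whole of `D`. -/
theorem FP.bool₃ (g : Bool → Bool → Bool → Bool) {b c d : α → Bool}
    (hb : FP ea D fun a => [some (b a)]) (hc : FP ea D fun a => [some (c a)])
    (hd : FP ea D fun a => [some (d a)]) : FP ea D fun a => [some (g (b a) (c a) (d a))] :=
  (FP.anyTriple g (p := fun a => [b a]) (s := fun a => [c a]) (t := fun a => [d a])
    hb hc hd).congr subset_rfl fun a _ => by simp [PolyTM.anyTriple]

theorem FP.bool₂ (g : Bool → Bool → Bool) {b c : α → Bool}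
    (hb : FP ea D fun a => [some (b a)]) (hc : FP ea D fun a => [some (c a)]) :
    FP ea D fun a => [some (g (b a) (c a))] :=
  FP.bool₃ (fun b c _ => g b c) hb hc hc

theorem FP.not {b : α → Bool} (hb : FP ea D fun a => [some (b a)]) :
    FP ea D fun a => [some (!b a)] :=
  FP.bool₂ (fun b _ => !b) hb hb

theorem FP.const_bool (c : Bool) : FP ea D fun _ => [some c] := by
  have h := (FP.id ea).mono (Set.subset_univ D)
  exact FP.bool₂ (fun _ _ => c) (FP.decide_eq h h) (FP.decide_eq h h)

end Closure

/-! ### Encoding a mask and a list of words by one binary word -/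

/-- The mask and the list of words that are encoded by a binary word. -/
def parts : Word → Word × List Word
  | [] => ([], [])
  | false :: u => ([], (parts u).1 :: (parts u).2)
  | [true] => ([], [])
  | true :: b :: u => (b :: (parts u).1, (parts u).2)

theorem encodeTuple_cons (u : Word) (us : List Word) :
    encodeTuple (u :: us) = u.map some ++ none :: encodeTuple us := by
  simp [encodeTuple]

/-- The end marker that `unpack` adds makes its value the encoding of a nonempty tuple for every
`u`, malformed words included. The mask and the list are then the first component and the rest. -/
theorem unpack_eq (u : Word) : unpack u = encodeTuple ((parts u).1 :: (parts u).2) := by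
  induction u using unpack.induct with
  | case1 => rfl
  | case2 u ih => simp [unpack, ih, parts, encodeTuple_cons]
  | case3 => rfl
  | case4 b u ih => simp [unpack, ih, parts, encodeTuple_cons]

/-- A bit costs two symbols and an end marker one, hence the factor 2. -/
theorem exists_parts_eq (m : Word) (xs : List Word) :
    ∃ u : Word, parts u = (m, xs) ∧ u.length ≤ 2 * (m.length + (encodeTuple xs).length) := by
  induction xs generalizing m with
  | nil =>
    induction m with
    | nil => exact ⟨[], rfl, by simp⟩
    | cons b m ih =>
      obtain ⟨u, hu, hl⟩ := ih
      exact ⟨true :: b :: u, by simp [parts, hu], by simp only [List.length_cons]; omega⟩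
  | cons x xs ih =>
    induction m with
    | nil =>
      obtain ⟨u, hu, hl⟩ := ih x
      refine ⟨false :: u, by simp [parts, hu], ?_⟩
      simp only [encodeTuple_cons, List.length_append, List.length_map, List.length_cons,
        List.length_nil]
      omega
    | cons b m ih =>
      obtain ⟨u, hu, hl⟩ := ih
      exact ⟨true :: b :: u, by simp [parts, hu], by simp only [List.length_cons]; omega⟩

theorem length_encodeTuple_le {xs : List Word} {B : ℕ} (h : ∀ x ∈ xs, x.length ≤ B) :
    (encodeTuple xs).length ≤ xs.length * (B + 1) := by
  induction xs with
  | nil => simp [encodeTuple]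
  | cons x xs ih =>
    have h1 := ih fun y hy => h y (List.mem_cons_of_mem _ hy)
    have h2 := h x List.mem_cons_self
    simp only [encodeTuple_cons, List.length_append, List.length_map, List.length_cons]
    rw [Nat.add_mul]
    omega

theorem map_some_append_inj {u u' : Word} {l l' : List Sym}
    (h : u.map some ++ none :: l = u'.map some ++ none :: l') : u = u' ∧ l = l' := by
  induction u generalizing u' with
  | nil => cases u' <;> simp_all
  | cons b u ih =>
    cases u' with
    | nil => simp at h
    | cons b' u' =>
      simp only [List.map_cons, List.cons_append, List.cons.injEq, Option.some.injEq] at h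
      obtain ⟨rfl, h⟩ := h
      obtain ⟨rfl, rfl⟩ := ih h
      exact ⟨rfl, rfl⟩

theorem encodeTuple_injective : Function.Injective encodeTuple := by
  intro us us' h
  induction us generalizing us' with
  | nil =>
    cases us' with
    | nil => rfl
    | cons u' us' => simp [encodeTuple] at h
  | cons u us ih =>
    cases us' with
    | nil => simp [encodeTuple] at h
    | cons u' us' =>
      rw [encodeTuple_cons, encodeTuple_cons] at h
      obtain ⟨rfl, h'⟩ := map_some_append_inj h
      rw [ih h']

/-- The set of positions at which a mask is true. -/
def maskSet (n : ℕ) (m : Word) : Set (Fin n) := {i | m.getD i false = true}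

/-- Turns agreement on a set of features into equality of two words, which a transducer can test.
Positions beyond the end of the mask count as not selected on both sides. -/
theorem select_ofFn_eq_iff {n : ℕ} (m : Word) (x y : Fin n → Word) :
    select m (List.ofFn x) = select m (List.ofFn y) ↔ ∀ i ∈ maskSet n m, x i = y i := by
  induction n generalizing m with
  | zero => simp
  | succ n ih =>
    rw [List.ofFn_succ, List.ofFn_succ]
    cases m with
    | nil => simp [select, maskSet]
    | cons b m =>
      have h := ih m (fun i => x i.succ) (fun i => y i.succ)
      cases b
      · simp only [select, h, maskSet, Set.mem_ofPred_eq, Fin.forall_fin_succ]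
        simp
      · simp only [select, List.cons.injEq, h, maskSet, Set.mem_ofPred_eq, Fin.forall_fin_succ]
        simp

theorem anyTriple_ofFn {n : ℕ} (g : Bool → Bool → Bool → Bool) (p : Fin n → Bool) (s t : Word) :
    anyTriple g (List.ofFn p) s t = true ↔
      ∃ i : Fin n, g (p i) (s.getD i false) (t.getD i false) = true := by
  induction n generalizing s t with
  | zero => simp [anyTriple]
  | succ n ih =>
    have h0 : ∀ u : Word, u.headD false = u.getD 0 false := by intro u; cases u <;> simp
    have h1 : ∀ (u : Word) (i : ℕ), u.tail.getD i false = u.getD (i + 1) false := by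
      intro u i; cases u <;> simp
    rw [List.ofFn_succ, anyTriple, Bool.or_eq_true, ih, Fin.exists_fin_succ]
    simp only [h0, h1, Fin.val_zero, Fin.val_succ]

open Classical in
theorem exists_maskSet_eq {n : ℕ} (S : Set (Fin n)) :
    ∃ m : Word, m.length = n ∧ maskSet n m = S := by
  refine ⟨List.ofFn fun i => decide (i ∈ S), by simp, ?_⟩
  ext i
  simp [maskSet, List.getD]

end PolyTM

/-! ### A characterization of prime-implicant explanations -/

namespace Fairness

section

variable {ι : Type*} {D : ι → Type*} {K : Type*} {C : Set (∀ i, D i)}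

theorem Subsumes.of_subset (x : C) {S T : Set ι} (h : S ⊆ T) : Subsumes x S T :=
  fun _ hy i hi => hy i (h hi)

theorem Subsumes.trans {x : C} {A B E : Set ι} (h : Subsumes x A B) (h' : Subsumes x B E) :
    Subsumes x A E := fun y hy => h y (h' y hy)

/-- Quantifying over weak AXps instead of AXps saves the quantifiers hidden in minimality.
Minimality of `S` itself survives as `¬ T ⊂ S`, because subsets of `S` subsume `S`. -/
theorem isPIExplanation_iff [Finite ι] {κ : C → K} {x : C} {S : Set ι} :
    IsPIExplanation κ x S ↔ IsWeakAXp κ x S ∧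
      ∀ T, IsWeakAXp κ x T → Subsumes x T S → Subsumes x S T ∧ ¬ T ⊂ S := by
  constructor
  · rintro ⟨hS, hmax⟩
    refine ⟨hS.prop, fun T hT hTS => ⟨?_, fun h => h.2 (hS.le_of_le hT h.1)⟩⟩
    by_contra hST
    -- Shrinking `T` to an AXp preserves strict subsumption of `S`, contradicting the maximality of
    -- `S`.
    obtain ⟨T', hT'T, hT'⟩ := exists_minimal_le_of_wellFoundedLT (IsWeakAXp κ x) T hT
    exact hmax ⟨T', hT', (Subsumes.of_subset x hT'T).trans hTS,
      fun h => hST (h.trans (Subsumes.of_subset x hT'T))⟩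
  · rintro ⟨hS, h⟩
    refine ⟨⟨hS, fun T hT hTS => ?_⟩, ?_⟩
    · by_contra hST
      exact (h T hT (Subsumes.of_subset x hTS)).2 ⟨hTS, hST⟩
    · rintro ⟨T, hT, hTS, hST⟩
      exact hST (h T hT.prop hTS).1

end

/-! ### The matrix of the two-quantifier description -/

namespace Classifier

variable (c : Classifier)

theorem toWords_injective {x y : c.feasible} (h : c.toWords x.1 = c.toWords y.1) : x = y := by
  apply Subtype.ext
  funext i
  exact Subtype.ext (congrFun (List.ofFn_injective h) i)

/-- The matrix of the formula for "`S` is a prime-implicant explanation of `κ(x)`", where `lz`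
and `ly` are lists of words that may or may not be instances. -/
def PIMatrix (x : c.feasible) (S T : Set (Fin c.n)) (lz ly : List PolyHierarchy.Word) : Prop :=
  (∀ z : c.feasible, c.toWords z.1 = lz → AgreeOn S z.1 x.1 → c.κ z = c.κ x) ∧
    ((∃ y : c.feasible, c.toWords y.1 = ly ∧ AgreeOn T y.1 x.1 ∧ c.κ y ≠ c.κ x) ∨
      (∃ y : c.feasible, c.toWords y.1 = ly ∧ AgreeOn S y.1 x.1 ∧ ¬ AgreeOn T y.1 x.1) ∨
      ((∀ z : c.feasible, c.toWords z.1 = lz → AgreeOn T z.1 x.1 → AgreeOn S z.1 x.1) ∧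
        ¬ T ⊂ S))

/-- `lz` is arbitrary because a quantified word need not decode to an instance. The witness `y` is
always an instance, so that it has a short code. -/
theorem exists_piMatrix {x : c.feasible} {S : Set (Fin c.n)} (h : IsPIExplanation c.κ x S)
    (T : Set (Fin c.n)) (lz : List PolyHierarchy.Word) :
    ∃ y : c.feasible, c.PIMatrix x S T lz (c.toWords y.1) := by
  rw [isPIExplanation_iff] at h
  obtain ⟨hS, h⟩ := h
  by_cases hT : IsWeakAXp c.κ x T
  · by_cases hTS : Subsumes x T S
    -- No counterexample is needed in this case; `x` is a filler.
    · exact ⟨x, fun z _ => hS z, .inr (.inr ⟨fun z _ => (h T hT hTS).1 z, (h T hT hTS).2⟩)⟩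
    · simp only [Subsumes, not_forall] at hTS
      obtain ⟨y, hy, hy'⟩ := hTS
      exact ⟨y, fun z _ => hS z, .inr (.inl ⟨y, rfl, hy, hy'⟩)⟩
  · simp only [IsWeakAXp, not_forall] at hT
    obtain ⟨y, hy, hy'⟩ := hT
    exact ⟨y, fun z _ => hS z, .inl ⟨y, rfl, hy, hy'⟩⟩

/-- If `T` is a weak AXp that subsumes `S`, no `y` can realize either of the first two disjuncts.
The third one then holds for every `z`, even though `ly` may vary with `z`. -/
theorem isPIExplanation_of_piMatrix {x : c.feasible} {S : Set (Fin c.n)}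
    (h : ∀ (T : Set (Fin c.n)) (z : c.feasible), ∃ ly, c.PIMatrix x S T (c.toWords z.1) ly) :
    IsPIExplanation c.κ x S := by
  rw [isPIExplanation_iff]
  refine ⟨fun z => ?_, fun T hT hTS => ?_⟩
  · obtain ⟨ly, h, -⟩ := h ∅ z
    exact h z rfl
  · have H : ∀ z : c.feasible, (AgreeOn T z.1 x.1 → AgreeOn S z.1 x.1) ∧ ¬ T ⊂ S := by
      intro z
      obtain ⟨ly, -, ⟨y, -, hy, hy'⟩ | ⟨y, -, hy, hy'⟩ | ⟨h, h'⟩⟩ := h T z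
      · exact absurd (hT y hy) hy'
      · exact absurd (hTS y hy) hy'
      · exact ⟨h z rfl, h'⟩
    -- `¬ T ⊂ S` stands under the quantifier over `z`; the instance `x` releases it.
    exact ⟨fun z => (H z).1, (H x).2⟩

end Classifier

/-! ### Total extensions of the given functions to arbitrary words -/

open PolyHierarchy PolyTM

namespace ClassifierScheme

variable (S : ClassifierScheme)

open Classical in
/-- Whether `w` describes a classifier. -/
noncomputable def codeTest (w : Word) : Bool := decide (w ∈ S.codes)

open Classical in
/-- Whether `l` is an instance of the classifier described by `w`. -/
noncomputable def instanceTest (w : Word) (l : List Word) : Bool :=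
  decide (∃ h : w ∈ S.codes, ∃ x ∈ (S.classifier ⟨w, h⟩).feasible,
    (S.classifier ⟨w, h⟩).toWords x = l)

open Classical in
/-- The mask of the protected features of the classifier described by `w`. -/
noncomputable def protectedMask (w : Word) : Word :=
  if h : w ∈ S.codes then List.ofFn (S.classifier ⟨w, h⟩).isProtected else []

open Classical in
/-- The class of the instance `l` of the classifier described by `w`. -/
noncomputable def classOf (w : Word) (l : List Word) : Word :=
  if h : ∃ (h : w ∈ S.codes) (x : (S.classifier ⟨w, h⟩).feasible),
      (S.classifier ⟨w, h⟩).toWords x.1 = l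
  then (S.classifier ⟨w, h.choose⟩).κ h.choose_spec.choose else []

variable {S}

theorem instanceTest_iff {w : Word} (hw : w ∈ S.codes) {l : List Word} :
    S.instanceTest w l = true ↔ ∃ x : (S.classifier ⟨w, hw⟩).feasible,
      (S.classifier ⟨w, hw⟩).toWords x.1 = l := by
  simp [instanceTest, hw]

/-- The chosen instance is the given one, since an instance is determined by its list of values. -/
theorem classOf_toWords {w : Word} (hw : w ∈ S.codes) (x : (S.classifier ⟨w, hw⟩).feasible) :
    S.classOf w ((S.classifier ⟨w, hw⟩).toWords x.1) = (S.classifier ⟨w, hw⟩).κ x := by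
  have h : ∃ (h : w ∈ S.codes) (x' : (S.classifier ⟨w, h⟩).feasible),
      (S.classifier ⟨w, h⟩).toWords x'.1 = (S.classifier ⟨w, hw⟩).toWords x.1 := ⟨hw, x, rfl⟩
  rw [classOf, dif_pos h]
  exact congrArg _ (Classifier.toWords_injective _ h.choose_spec.choose_spec)

/-! ### The verifier -/

/-- The mask in the `i`-th component of a tuple. -/
def maskAt (i : ℕ) (v : List Word) : Word := (parts (v.getD i [])).1

/-- The list of words in the `i`-th component of a tuple. -/
def listAt (i : ℕ) (v : List Word) : List Word := (parts (v.getD i [])).2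

/-- Whether the lists in the components `i` and `j` agree on the mask in the component `m`. -/
def agreeTest (m i j : ℕ) (v : List Word) : Bool :=
  decide (select (maskAt m v) (listAt i v) = select (maskAt m v) (listAt j v))

variable (S)

/-- Whether the list in component `i` is an instance. -/
noncomputable def instanceTestAt (i : ℕ) (v : List Word) : Bool :=
  S.instanceTest (v.getD 0 []) (listAt i v)

/-- Whether the list in component `i` is an instance with the same class as that in component
`j`. -/
noncomputable def sameClassTest (i j : ℕ) (v : List Word) : Bool :=
  S.instanceTestAt i v && decide (S.classOf (v.getD 0 []) (listAt i v) =
    S.classOf (v.getD 0 []) (listAt j v))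

/-- Whether the mask in component `s` contains no protected feature. -/
noncomputable def fairTest (s : ℕ) (v : List Word) : Bool :=
  !anyTriple (fun p a _ => p && a) (S.protectedMask (v.getD 0 [])) (maskAt s v) (maskAt s v)

/-- Whether the mask in component `t` is a proper subset of that in component `s`. -/
noncomputable def ssubsetTest (t s : ℕ) (v : List Word) : Bool :=
  !anyTriple (fun _ a b => b && !a) (S.protectedMask (v.getD 0 [])) (maskAt s v) (maskAt t v) &&
    anyTriple (fun _ a b => a && !b) (S.protectedMask (v.getD 0 [])) (maskAt s v) (maskAt t v)

/-- Tests `Classifier.PIMatrix`, where `x`, `s`, `z`, `y` are the components that contain `x`,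
`S`, both `T` and `z`, and `y`. -/
noncomputable def matrixTest (x s z y : ℕ) (v : List Word) : Bool :=
  (!(S.instanceTestAt z v && agreeTest s z x v) || S.sameClassTest z x v) &&
    ((S.instanceTestAt y v && agreeTest z y x v && !S.sameClassTest y x v) ||
      ((S.instanceTestAt y v && agreeTest s y x v && !agreeTest z y x v) ||
        ((!(S.instanceTestAt z v && agreeTest z z x v) || agreeTest s z x v) &&
          !S.ssubsetTest z s v)))

/-- Whether the first component is a description and, if component `x` contains an instance,
then `g` holds for the results of `fairTest` and `matrixTest`. -/
noncomputable def verifier (g : Bool → Bool → Bool) (x s z y : ℕ) (v : List Word) : Bool :=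
  S.codeTest (v.getD 0 []) &&
    (!S.instanceTestAt x v || g (S.fairTest s v) (S.matrixTest x s z y v))

variable {S}

section Semantics

theorem agreeTest_iff {w : Word} (hw : w ∈ S.codes) {v : List Word} {m i j : ℕ} {x y : (S.classifier ⟨w, hw⟩).feasible}
    (hx : (S.classifier ⟨w, hw⟩).toWords x.1 = listAt i v)
    (hy : (S.classifier ⟨w, hw⟩).toWords y.1 = listAt j v) : agreeTest m i j v = true ↔
      AgreeOn (maskSet (S.classifier ⟨w, hw⟩).n (maskAt m v)) x.1 y.1 := by
  rw [agreeTest, decide_eq_true_iff, ← hx, ← hy, Classifier.toWords, Classifier.toWords,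
    select_ofFn_eq_iff]
  exact forall₂_congr fun i _ => Subtype.ext_iff.symm

variable {w : Word} (hw : w ∈ S.codes) {v : List Word} (hv : v.getD 0 [] = w)

include hv

theorem instanceTestAt_iff (i : ℕ) : S.instanceTestAt i v = true ↔
    ∃ x : (S.classifier ⟨w, hw⟩).feasible, (S.classifier ⟨w, hw⟩).toWords x.1 = listAt i v := by
  rw [instanceTestAt, hv, instanceTest_iff hw]

theorem fairTest_iff (s : ℕ) : S.fairTest s v = true ↔
    IsFairExplanation (S.classifier ⟨w, hw⟩).protectedFeatures
      (maskSet (S.classifier ⟨w, hw⟩).n (maskAt s v)) := by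
  rw [fairTest, Bool.not_eq_true', ← Bool.not_eq_true, hv, protectedMask, dif_pos hw,
    anyTriple_ofFn, IsFairExplanation, Set.disjoint_left]
  simp only [Bool.and_eq_true, not_exists, not_and, maskSet, Classifier.protectedFeatures,
    Set.mem_ofPred_eq]
  exact forall_congr' fun i => ⟨fun h a b => h b a, fun h a b => h b a⟩

/-- The protected mask serves only as a ruler of length `n`: the masks decoded from quantified words
may be shorter or longer. -/
theorem ssubsetTest_iff (t s : ℕ) : S.ssubsetTest t s v = true ↔
    maskSet (S.classifier ⟨w, hw⟩).n (maskAt t v) ⊂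
      maskSet (S.classifier ⟨w, hw⟩).n (maskAt s v) := by
  rw [ssubsetTest, Bool.and_eq_true, Bool.not_eq_true', ← Bool.not_eq_true, hv, protectedMask,
    dif_pos hw, anyTriple_ofFn, anyTriple_ofFn, Set.ssubset_iff_exists]
  simp only [Bool.and_eq_true, not_exists, not_and, maskSet, Set.subset_def, Set.mem_ofPred_eq,
    Bool.not_eq_true', Bool.not_eq_false, Bool.not_eq_true]

theorem sameClassTest_iff {i j : ℕ} {x y : (S.classifier ⟨w, hw⟩).feasible}
    (hx : (S.classifier ⟨w, hw⟩).toWords x.1 = listAt i v)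
    (hy : (S.classifier ⟨w, hw⟩).toWords y.1 = listAt j v) : S.sameClassTest i j v = true ↔
      (S.classifier ⟨w, hw⟩).κ x = (S.classifier ⟨w, hw⟩).κ y := by
  rw [sameClassTest, Bool.and_eq_true, decide_eq_true_iff, ← hx, ← hy, hv, classOf_toWords hw,
    classOf_toWords hw, instanceTestAt_iff hw hv]
  exact ⟨fun h => h.2, fun h => ⟨⟨x, hx⟩, h⟩⟩

theorem matrixTest_iff {x s z y : ℕ} {x' : (S.classifier ⟨w, hw⟩).feasible}
    (hx : (S.classifier ⟨w, hw⟩).toWords x'.1 = listAt x v) :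
    S.matrixTest x s z y v = true ↔ (S.classifier ⟨w, hw⟩).PIMatrix x'
      (maskSet _ (maskAt s v)) (maskSet _ (maskAt z v)) (listAt z v) (listAt y v) := by
  -- The bit `b` depends only on the list, so a quantifier over the instances with that list
  -- collapses: `∀` to a guarded implication, `∃` to a guarded conjunction.
  have hall : ∀ (i : ℕ) (P : (S.classifier ⟨w, hw⟩).feasible → Prop) (b : Bool),
      (∀ z', (S.classifier ⟨w, hw⟩).toWords z'.1 = listAt i v → (P z' ↔ b = true)) →
      ((∀ z', (S.classifier ⟨w, hw⟩).toWords z'.1 = listAt i v → P z') ↔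
        (!S.instanceTestAt i v || b) = true) := by
    intro i P b h
    rw [Bool.or_eq_true, Bool.not_eq_true', ← Bool.not_eq_true, instanceTestAt_iff hw hv]
    by_cases hz : ∃ z' : (S.classifier ⟨w, hw⟩).feasible,
      (S.classifier ⟨w, hw⟩).toWords z'.1 = listAt i v
    · obtain ⟨z', hz⟩ := hz
      have : ¬ ¬ ∃ z' : (S.classifier ⟨w, hw⟩).feasible,
        (S.classifier ⟨w, hw⟩).toWords z'.1 = listAt i v := not_not.2 ⟨z', hz⟩
      rw [or_iff_right this]
      exact ⟨fun H => (h z' hz).1 (H z' hz), fun H z'' hz'' => (h z'' hz'').2 H⟩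
    · exact ⟨fun _ => .inl hz, fun _ z' hz' => absurd ⟨z', hz'⟩ hz⟩
  have hex : ∀ (i : ℕ) (P : (S.classifier ⟨w, hw⟩).feasible → Prop) (b : Bool),
      (∀ z', (S.classifier ⟨w, hw⟩).toWords z'.1 = listAt i v → (P z' ↔ b = true)) →
      ((∃ z', (S.classifier ⟨w, hw⟩).toWords z'.1 = listAt i v ∧ P z') ↔
        (S.instanceTestAt i v && b) = true) := by
    intro i P b h
    rw [Bool.and_eq_true, instanceTestAt_iff hw hv]
    constructor
    · rintro ⟨z', hz, hP⟩
      exact ⟨⟨z', hz⟩, (h z' hz).1 hP⟩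
    · rintro ⟨⟨z', hz⟩, hb⟩
      exact ⟨z', hz, (h z' hz).2 hb⟩
  have h₁ := hall z (fun z' => AgreeOn (maskSet _ (maskAt s v)) z'.1 x'.1 →
    (S.classifier ⟨w, hw⟩).κ z' = (S.classifier ⟨w, hw⟩).κ x')
    (!agreeTest s z x v || S.sameClassTest z x v) (fun z' hz => by
      rw [← agreeTest_iff hw hz hx, ← sameClassTest_iff hw hv hz hx]
      cases agreeTest s z x v <;> simp)
  have h₂ := hex y (fun y' => AgreeOn (maskSet _ (maskAt z v)) y'.1 x'.1 ∧
    (S.classifier ⟨w, hw⟩).κ y' ≠ (S.classifier ⟨w, hw⟩).κ x')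
    (agreeTest z y x v && !S.sameClassTest y x v) (fun y' hy => by
      rw [← agreeTest_iff hw hy hx, Ne, ← sameClassTest_iff hw hv hy hx]
      simp)
  have h₃ := hex y (fun y' => AgreeOn (maskSet _ (maskAt s v)) y'.1 x'.1 ∧
    ¬ AgreeOn (maskSet _ (maskAt z v)) y'.1 x'.1)
    (agreeTest s y x v && !agreeTest z y x v) (fun y' hy => by
      rw [← agreeTest_iff hw hy hx, ← agreeTest_iff hw hy hx]
      simp)
  have h₄ := hall z (fun z' => AgreeOn (maskSet _ (maskAt z v)) z'.1 x'.1 →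
    AgreeOn (maskSet _ (maskAt s v)) z'.1 x'.1)
    (!agreeTest z z x v || agreeTest s z x v) (fun z' hz => by
      rw [← agreeTest_iff hw hz hx, ← agreeTest_iff hw hz hx]
      cases agreeTest z z x v <;> simp)
  rw [Classifier.PIMatrix, h₁, h₂, h₃, h₄, ← ssubsetTest_iff hw hv, matrixTest]
  simp only [Bool.and_eq_true, Bool.or_eq_true, Bool.not_and, Bool.or_assoc, Bool.and_assoc,
    Bool.not_eq_true', Bool.not_eq_true]

theorem verifier_iff {g : Bool → Bool → Bool} {x s z y : ℕ} :
    S.verifier g x s z y v = true ↔ ∀ x' : (S.classifier ⟨w, hw⟩).feasible,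
      (S.classifier ⟨w, hw⟩).toWords x'.1 = listAt x v →
        g (S.fairTest s v) (S.matrixTest x s z y v) = true := by
  have hc : S.codeTest (v.getD 0 []) = true := by rw [hv]; simpa [codeTest] using hw
  rw [verifier, hc, Bool.true_and, Bool.or_eq_true, Bool.not_eq_true', ← Bool.not_eq_true,
    instanceTestAt_iff hw hv]
  constructor
  · rintro (h | h) x' hx'
    · exact absurd ⟨x', hx'⟩ h
    · exact h
  · intro h
    by_cases hx : ∃ x' : (S.classifier ⟨w, hw⟩).feasible,
      (S.classifier ⟨w, hw⟩).toWords x'.1 = listAt x v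
    · obtain ⟨x', hx⟩ := hx
      exact .inr (h x' hx)
    · exact .inl hx

end Semantics

/-! ### The verifier runs in polynomial time -/

theorem fp_getD {α : Type} {ea : α → List Sym} {D : Set α} {us : α → List Word} (i : ℕ)
    (h : FP ea D fun a => encodeTuple (us a)) (hi : ∀ a ∈ D, i < (us a).length) :
    FP ea D fun a => ((us a).getD i []).map some := by
  have hcons : FP ea D fun a => encodeTuple ((us a).headD [] :: (us a).tail) :=
    h.congr subset_rfl fun a ha => by
      have := hi a ha
      cases hu : us a with
      | nil => simp [hu] at this
      | cons u l => rfl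
  induction i generalizing us with
  | zero => exact hcons.first.congr subset_rfl fun a _ => by cases us a <;> rfl
  | succ i ih =>
    have hi' : ∀ a ∈ D, i < (us a).tail.length := fun a ha => by
      have := hi a ha
      simp only [List.length_tail]
      omega
    refine (ih hcons.rest hi' ?_).congr subset_rfl fun a _ => by cases us a <;> simp
    refine hcons.rest.congr subset_rfl fun a ha => ?_
    have := hi' a ha
    cases hu : (us a).tail with
    | nil => simp [hu] at this
    | cons u l => rfl

section Time

/-- The tuples of `k` words. -/
def tuples (k : ℕ) : Set (List Word) := {v | v.length = k}

/-- The tuples of `k` words whose first component is a description. -/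
def codeTuples (S : ClassifierScheme) (k : ℕ) : Set (List Word) :=
  {v | v ∈ tuples k ∧ S.codeTest (v.getD 0 []) = true}

variable {k : ℕ}

theorem fp_word {i : ℕ} (hi : i < k) :
    FP encodeTuple (tuples k) fun v => (v.getD i []).map some :=
  fp_getD i ((FP.id encodeTuple).mono (Set.subset_univ _)) fun _ h => hi.trans_eq h.symm

theorem fp_unpack {i : ℕ} (hi : i < k) :
    FP encodeTuple (tuples k) fun v => encodeTuple (maskAt i v :: listAt i v) :=
  (fp_word hi).unpack.congr subset_rfl fun _ _ => unpack_eq _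

theorem fp_maskAt {i : ℕ} (hi : i < k) :
    FP encodeTuple (tuples k) fun v => (maskAt i v).map some := (fp_unpack hi).first

theorem fp_listAt {i : ℕ} (hi : i < k) :
    FP encodeTuple (tuples k) fun v => encodeTuple (listAt i v) := (fp_unpack hi).rest

theorem fp_agreeTest {m i j : ℕ} (hm : m < k) (hi : i < k) (hj : j < k) :
    FP encodeTuple (tuples k) fun v => [some (agreeTest m i j v)] :=
  (FP.decide_eq ((fp_maskAt hm).select (fp_listAt hi))
    ((fp_maskAt hm).select (fp_listAt hj))).congr subset_rfl fun v _ => by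
      simp [agreeTest, encodeTuple_injective.eq_iff]

theorem fp_join {i : ℕ} (hk : 0 < k) (hi : i < k) :
    FP encodeTuple (tuples k) fun v => encodeTuple (v.getD 0 [] :: listAt i v) :=
  ((fp_word hk).join (fp_listAt hi)).congr subset_rfl fun _ _ => (encodeTuple_cons _ _).symm

variable (hS : S.IsPolyTime)

include hS

theorem fp_codeTest (hk : 0 < k) :
    FP encodeTuple (tuples k) fun v => [some (S.codeTest (v.getD 0 []))] :=
  (fp_word hk).comp (FP.of_polyTime hS.codes_polyTime (fun x => x.getD false) some
    (fun r => r.map some) fun r => by simp [List.map_map, Function.comp_def])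
    fun v _ => ⟨v.getD 0 [], trivial, rfl, rfl⟩

theorem fp_protectedMask_code : FP (fun r : S.codes => (r : Word).map some) Set.univ
    fun r => (List.ofFn (S.classifier r).isProtected).map some :=
  FP.of_polyTime hS.features_polyTime (fun x => x.getD false) some
    (fun r : S.codes => (r : Word).map some) fun r => by simp [List.map_map, Function.comp_def]

theorem fp_protectedMask (hk : 0 < k) :
    FP encodeTuple (codeTuples S k) fun v => (S.protectedMask (v.getD 0 [])).map some :=
  ((fp_word hk).mono fun _ h => h.1).comp (fp_protectedMask_code hS) fun v hv => by
    have hw : v.getD 0 [] ∈ S.codes := by simpa [codeTest] using hv.2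
    exact ⟨⟨v.getD 0 [], hw⟩, trivial, rfl, by simp only [protectedMask, dif_pos hw]⟩

/-- The hypothesis on feasibility speaks only about descriptions, hence the domain `codeTuples`. -/
theorem fp_instanceTestAt {i : ℕ} (hk : 0 < k) (hi : i < k) :
    FP encodeTuple (codeTuples S k) fun v => [some (S.instanceTestAt i v)] :=
  ((fp_join hk hi).mono fun _ h => h.1).comp
    (FP.of_polyTime hS.feasible_polyTime (fun x => x) some _ fun _ => List.map_id _)
    fun v hv => by
      have hw : v.getD 0 [] ∈ S.codes := by simpa [codeTest] using hv.2
      exact ⟨(⟨v.getD 0 [], hw⟩, listAt i v), trivial, rfl, 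
        congrArg (fun b => [some b]) (decide_eq_decide.2 ⟨fun h => ⟨hw, h⟩, fun ⟨_, h⟩ => h⟩)⟩

theorem fp_classOf {i : ℕ} (hk : 0 < k) (hi : i < k) :
    FP encodeTuple {v | v ∈ codeTuples S k ∧ S.instanceTestAt i v = true}
      fun v => (S.classOf (v.getD 0 []) (listAt i v)).map some :=
  ((fp_join hk hi).mono fun _ h => h.1.1).comp
    (FP.of_polyTime hS.classify_polyTime (fun x => x) some _ fun _ => List.map_id _)
    fun v hv => by
      have hw : v.getD 0 [] ∈ S.codes := by simpa [codeTest] using hv.1.2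
      obtain ⟨x, hx⟩ := (instanceTestAt_iff hw rfl i).1 hv.2
      exact ⟨⟨⟨v.getD 0 [], hw⟩, x⟩, trivial, by rw [hx], by rw [← hx, classOf_toWords hw]⟩

/-- The classifier may be called on instances only. Component `j` is an instance by the choice of
domain; component `i` is tested first, and the answer is `false` if it is not one. -/
theorem fp_sameClassTest {i j : ℕ} (hk : 0 < k) (hi : i < k) (hj : j < k) :
    FP encodeTuple {v | v ∈ codeTuples S k ∧ S.instanceTestAt j v = true}
      fun v => [some (S.sameClassTest i j v)] := by
  refine FP.ite ((fp_instanceTestAt hS hk hi).mono fun _ h => h.1) ?_ ?_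
  · refine (FP.decide_eq ((fp_classOf hS hk hi).mono fun _ h => ⟨h.1.1, h.2⟩)
      ((fp_classOf hS hk hj).mono fun _ h => h.1)).congr subset_rfl fun v hv => ?_
    have : S.instanceTestAt i v = true := hv.2
    simp [sameClassTest, this, (List.map_injective_iff.2 (Option.some_injective Bool)).eq_iff]
  · refine (FP.const_bool false).congr subset_rfl fun v hv => ?_
    have : S.instanceTestAt i v = false := hv.2
    simp [sameClassTest, this]

theorem fp_fairTest {s : ℕ} (hk : 0 < k) (hs : s < k) :
    FP encodeTuple (codeTuples S k) fun v => [some (S.fairTest s v)] := by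
  have hm := (fp_maskAt hs).mono (E := codeTuples S k) fun _ h => h.1
  exact (FP.anyTriple (fun p a _ => p && a) (fp_protectedMask hS hk) hm hm).not

theorem fp_ssubsetTest {t s : ℕ} (hk : 0 < k) (ht : t < k) (hs : s < k) :
    FP encodeTuple (codeTuples S k) fun v => [some (S.ssubsetTest t s v)] := by
  have hmt := (fp_maskAt ht).mono (E := codeTuples S k) fun _ h => h.1
  have hms := (fp_maskAt hs).mono (E := codeTuples S k) fun _ h => h.1
  have hp := fp_protectedMask hS hk
  exact FP.bool₂ (fun a b => !a && b) (FP.anyTriple (fun _ a b => b && !a) hp hms hmt)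
    (FP.anyTriple (fun _ a b => a && !b) hp hms hmt)

theorem fp_matrixTest {x s z y : ℕ} (hk : 0 < k) (hx : x < k) (hs : s < k) (hz : z < k)
    (hy : y < k) : FP encodeTuple {v | v ∈ codeTuples S k ∧ S.instanceTestAt x v = true}
      fun v => [some (S.matrixTest x s z y v)] := by
  have agree : ∀ {m i j : ℕ}, m < k → i < k → j < k →
      FP encodeTuple {v | v ∈ codeTuples S k ∧ S.instanceTestAt x v = true}
        fun v => [some (agreeTest m i j v)] :=
    fun hm hi hj => (fp_agreeTest hm hi hj).mono fun _ h => h.1.1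
  have inst : ∀ {i : ℕ}, i < k →
      FP encodeTuple {v | v ∈ codeTuples S k ∧ S.instanceTestAt x v = true}
        fun v => [some (S.instanceTestAt i v)] :=
    fun hi => (fp_instanceTestAt hS hk hi).mono fun _ h => h.1
  have hsub := (fp_ssubsetTest hS hk hz hs).mono
    (E := {v | v ∈ codeTuples S k ∧ S.instanceTestAt x v = true}) fun _ h => h.1
  have h₁ := FP.bool₃ (fun a b c => !(a && b) || c) (inst hz) (agree hs hz hx)
    (fp_sameClassTest hS hk hz hx)
  have h₂ := FP.bool₃ (fun a b c => a && b && !c) (inst hy) (agree hz hy hx)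
    (fp_sameClassTest hS hk hy hx)
  have h₃ := FP.bool₃ (fun a b c => a && b && !c) (inst hy) (agree hs hy hx) (agree hz hy hx)
  have h₄ := FP.bool₃ (fun a b c => !(a && b) || c) (inst hz) (agree hz hz hx) (agree hs hz hx)
  exact FP.bool₂ (fun a b => a && b) h₁ (FP.bool₂ (fun a b => a || b) h₂
    (FP.bool₂ (fun a b => a || b) h₃ (FP.bool₂ (fun a b => a && !b) h₄ hsub)))

/-- The nested tests follow the promises: description first, then instance `x`, and only then the
matrix. -/
theorem fp_verifier (g : Bool → Bool → Bool) {x s z y : ℕ} (hk : 0 < k) (hx : x < k)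
    (hs : s < k) (hz : z < k) (hy : y < k) :
    FP encodeTuple (tuples k) fun v => [some (S.verifier g x s z y v)] := by
  refine FP.ite (fp_codeTest hS hk) (FP.ite (fp_instanceTestAt hS hk hx) ?_ ?_) ?_
  · refine (FP.bool₂ g ((fp_fairTest hS hk hs).mono fun _ h => h.1)
      (fp_matrixTest hS hk hx hs hz hy)).congr subset_rfl fun v hv => ?_
    have h₁ : S.codeTest (v.getD 0 []) = true := hv.1.2
    have h₂ : S.instanceTestAt x v = true := hv.2
    simp only [verifier, h₁, h₂, Bool.true_and, Bool.not_true, Bool.false_or]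
  · refine (FP.const_bool true).congr subset_rfl fun v hv => ?_
    have h₁ : S.codeTest (v.getD 0 []) = true := hv.1.2
    have h₂ : S.instanceTestAt x v = false := hv.2
    simp only [verifier, h₁, h₂, Bool.true_and, Bool.not_false, Bool.true_or]
  · refine (FP.const_bool false).congr subset_rfl fun v hv => ?_
    have h₁ : S.codeTest (v.getD 0 []) = false := hv.2
    simp only [verifier, h₁, Bool.false_and]

theorem polyTime_verifier (g : Bool → Bool → Bool) {x s z y : ℕ} (hx : x < k + 1)
    (hs : s < k + 1) (hz : z < k + 1) (hy : y < k + 1) :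
    PolyTime (fun v : List.Vector Word (k + 1) => encodeTuple v.toList) Computability.encodeBool
      fun v => S.verifier g x s z y v.toList :=
  FP.polyTime_bool <| (FP.id _).comp (fp_verifier hS g (Nat.succ_pos k) hx hs hz hy)
    fun v _ => ⟨v.toList, v.toList_length, rfl, rfl⟩

/-- One kind of certificate serves every quantifier: a set and an instance together, either of which
may be a filler. -/
theorem exists_certificate : ∃ q : Polynomial ℕ, ∀ (r : S.codes) (A : Set (Fin (S.classifier r).n))
    (x : (S.classifier r).feasible), ∃ u : Word, u.length ≤ q.eval (r : Word).length ∧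
      maskSet (S.classifier r).n (parts u).1 = A ∧ (parts u).2 = (S.classifier r).toWords x.1 := by
  obtain ⟨p, hp⟩ := hS.values_length
  obtain ⟨d, hd⟩ := (fp_protectedMask_code hS).exists_length_le
  -- `d` bounds the number of features, because the list of features is the output of a polynomial
  -- time machine; each value takes at most `p` bits and an end marker.
  refine ⟨2 * (d + d * (p + 1)), fun r A x => ?_⟩
  obtain ⟨m, hm, hA⟩ := exists_maskSet_eq A
  obtain ⟨u, hu, hl⟩ := exists_parts_eq m ((S.classifier r).toWords x.1)
  refine ⟨u, hl.trans ?_, by rw [hu, hA], by rw [hu]⟩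
  have hn : (S.classifier r).n ≤ d.eval (r : Word).length := by simpa using hd r trivial
  have hx : (encodeTuple ((S.classifier r).toWords x.1)).length ≤
      (S.classifier r).n * (p.eval (r : Word).length + 1) := by
    refine (length_encodeTuple_le (B := p.eval (r : Word).length) fun y hy => ?_).trans_eq ?_
    · obtain ⟨i, rfl⟩ := (List.mem_ofFn' _ _).1 hy
      exact hp r x.1 x.2 i
    · simp [Classifier.toWords]
  have := hx.trans (Nat.mul_le_mul_right _ hn)
  simp only [Polynomial.eval_mul, Polynomial.eval_add, Polynomial.eval_one,
    Polynomial.eval_ofNat]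
  omega

end Time

/-! ### Membership in the polynomial hierarchy -/

theorem verifier_eq_false {g : Bool → Bool → Bool} {x s z y : ℕ} {v : List Word}
    (h : v.getD 0 [] ∉ S.codes) : S.verifier g x s z y v = false := by
  have : S.codeTest (v.getD 0 []) = false := by simpa [codeTest] using h
  rw [verifier, this, Bool.false_and]

/-- The four words carry `x`, then `S`, then `(T, z)`, then `y`. -/
theorem existentialFairnessProblem_mem_piP (hS : S.IsPolyTime) :
    S.existentialFairnessProblem ∈ PiP 4 := by
  obtain ⟨q, hq⟩ := exists_certificate hS
  refine ⟨q, fun v => S.verifier (fun a b => a && b) 1 2 3 4 v.toList,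
    polyTime_verifier hS _ (by norm_num) (by norm_num) (by norm_num) (by norm_num), fun w => ?_⟩
  simp only [Alternating, List.Vector.toList_cons, List.Vector.toList_nil]
  by_cases hw : w ∈ S.codes
  swap
  · refine ⟨fun ⟨h, _⟩ => absurd h hw, fun h => ?_⟩
    obtain ⟨u₂, -, h⟩ := h [] (Nat.zero_le _)
    obtain ⟨u₄, -, h⟩ := h [] (Nat.zero_le _)
    rw [verifier_eq_false hw] at h
    cases h
  have hq := hq ⟨w, hw⟩
  constructor
  · rintro ⟨_, hfair⟩ u₁ -
    by_cases hx : ∃ x : (S.classifier ⟨w, hw⟩).feasible,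
      (S.classifier ⟨w, hw⟩).toWords x.1 = (parts u₁).2
    · obtain ⟨x, hx⟩ := hx
      obtain ⟨A, hA, hAP⟩ := hfair x
      -- Only the mask of `u₂` is read; `x` fills the instance part.
      obtain ⟨u₂, hu₂, hm, -⟩ := hq A x
      refine ⟨u₂, hu₂, fun u₃ _ => ?_⟩
      obtain ⟨y, hy⟩ := Classifier.exists_piMatrix _ hA (maskSet _ (parts u₃).1) (parts u₃).2
      obtain ⟨u₄, hu₄, -, hl⟩ := hq ∅ y
      refine ⟨u₄, hu₄, (verifier_iff hw rfl).2 fun x' hx' => ?_⟩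
      rw [Bool.and_eq_true, fairTest_iff hw rfl, matrixTest_iff hw rfl hx']
      obtain rfl := Classifier.toWords_injective _ (hx'.trans hx.symm)
      change IsFairExplanation _ (maskSet _ (parts u₂).1) ∧ Classifier.PIMatrix _ _
        (maskSet _ (parts u₂).1) (maskSet _ (parts u₃).1) (parts u₃).2 (parts u₄).2
      rw [hm, hl]
      exact ⟨hAP, hy⟩
    · refine ⟨[], Nat.zero_le _, fun u₃ _ => ⟨[], Nat.zero_le _,
        (verifier_iff hw rfl).2 fun x' hx' => absurd ⟨x', hx'⟩ hx⟩⟩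
  · intro h
    refine ⟨hw, fun x => ?_⟩
    obtain ⟨u₁, hu₁, -, hl⟩ := hq ∅ x
    obtain ⟨u₂, -, h⟩ := h u₁ hu₁
    have key : ∀ u₃ : Word, u₃.length ≤ q.eval w.length → ∃ u₄ : Word,
        IsFairExplanation (S.classifier ⟨w, hw⟩).protectedFeatures (maskSet _ (parts u₂).1) ∧
        Classifier.PIMatrix _ x (maskSet _ (parts u₂).1) (maskSet _ (parts u₃).1) (parts u₃).2
          (parts u₄).2 := by
      intro u₃ hu₃
      obtain ⟨u₄, -, h⟩ := h u₃ hu₃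
      have := (verifier_iff hw rfl).1 h x hl.symm
      rw [Bool.and_eq_true, fairTest_iff hw rfl, matrixTest_iff hw rfl hl.symm] at this
      exact ⟨u₄, this⟩
    refine ⟨maskSet _ (parts u₂).1, Classifier.isPIExplanation_of_piMatrix _ fun T z => ?_, ?_⟩
    · obtain ⟨u₃, hu₃, hT, hz⟩ := hq T z
      obtain ⟨u₄, -, h⟩ := key u₃ hu₃
      rw [hT, hz] at h
      exact ⟨_, h⟩
    -- Fairness does not involve `u₃`, so any admissible word will do.
    · exact (key [] (Nat.zero_le _)).choose_spec.1

/-- Here `x` and `S` are both quantified universally and share the word `u₁`. "PI-explanation"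
occurs negatively, so its quantifiers turn into `∃ (T, z) ∀ y`. -/
theorem universalFairnessProblem_mem_piP (hS : S.IsPolyTime) :
    S.universalFairnessProblem ∈ PiP 3 := by
  obtain ⟨q, hq⟩ := exists_certificate hS
  refine ⟨q, fun v => S.verifier (fun a b => a || !b) 1 1 2 3 v.toList,
    polyTime_verifier hS _ (by norm_num) (by norm_num) (by norm_num) (by norm_num), fun w => ?_⟩
  simp only [Alternating, List.Vector.toList_cons, List.Vector.toList_nil]
  by_cases hw : w ∈ S.codes
  swap
  · refine ⟨fun ⟨h, _⟩ => absurd h hw, fun h => ?_⟩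
    obtain ⟨u₂, -, h⟩ := h [] (Nat.zero_le _)
    have h := h [] (Nat.zero_le _)
    rw [verifier_eq_false hw] at h
    cases h
  have hq := hq ⟨w, hw⟩
  have hV : ∀ {u₁ u₂ u₃ : Word} {x : (S.classifier ⟨w, hw⟩).feasible},
      (S.classifier ⟨w, hw⟩).toWords x.1 = (parts u₁).2 →
      (S.verifier (fun a b => a || !b) 1 1 2 3 [w, u₁, u₂, u₃] = true ↔
        (Classifier.PIMatrix _ x (maskSet _ (parts u₁).1) (maskSet _ (parts u₂).1)
          (parts u₂).2 (parts u₃).2 →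
        IsFairExplanation (S.classifier ⟨w, hw⟩).protectedFeatures (maskSet _ (parts u₁).1))) := by
    intro u₁ u₂ u₃ x hx
    rw [verifier_iff hw rfl]
    have : (∀ x' : (S.classifier ⟨w, hw⟩).feasible,
        (S.classifier ⟨w, hw⟩).toWords x'.1 = listAt 1 [w, u₁, u₂, u₃] →
        (S.fairTest 1 [w, u₁, u₂, u₃] || !S.matrixTest 1 1 2 3 [w, u₁, u₂, u₃]) = true) ↔
        (S.fairTest 1 [w, u₁, u₂, u₃] || !S.matrixTest 1 1 2 3 [w, u₁, u₂, u₃]) = true :=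
      ⟨fun h => h x hx, fun h _ _ => h⟩
    rw [this, Bool.or_eq_true, Bool.not_eq_true', ← Bool.not_eq_true, fairTest_iff hw rfl,
      matrixTest_iff hw rfl hx, or_comm, ← imp_iff_not_or]
    rfl
  constructor
  · rintro ⟨_, hfair⟩ u₁ -
    by_cases hx : ∃ x : (S.classifier ⟨w, hw⟩).feasible,
      (S.classifier ⟨w, hw⟩).toWords x.1 = (parts u₁).2
    · obtain ⟨x, hx⟩ := hx
      by_cases hPI : IsPIExplanation (S.classifier ⟨w, hw⟩).κ x (maskSet _ (parts u₁).1)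
      · exact ⟨[], Nat.zero_le _, fun u₃ _ => (hV hx).2 fun _ => hfair x _ hPI⟩
      -- A pair `(T, z)` that refutes the matrix for every `y` is the existential witness.
      · have := mt (Classifier.isPIExplanation_of_piMatrix _) hPI
        simp only [not_forall, not_exists] at this
        obtain ⟨T, z, h⟩ := this
        obtain ⟨u₂, hu₂, hT, hz⟩ := hq T z
        refine ⟨u₂, hu₂, fun u₃ _ => (hV hx).2 fun h' => ?_⟩
        rw [hT, hz] at h'
        exact absurd h' (h _)
    · exact ⟨[], Nat.zero_le _, fun u₃ _ =>
        (verifier_iff hw rfl).2 fun x' hx' => absurd ⟨x', hx'⟩ hx⟩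
  · intro h
    refine ⟨hw, fun x A hA => ?_⟩
    obtain ⟨u₁, hu₁, hm, hl⟩ := hq A x
    obtain ⟨u₂, -, h⟩ := h u₁ hu₁
    -- For a PI-explanation no choice of `u₂` refutes the matrix: some `y` satisfies it, and the
    -- verifier at that `y` enforces fairness.
    obtain ⟨y, hy⟩ := Classifier.exists_piMatrix _ hA (maskSet _ (parts u₂).1) (parts u₂).2
    obtain ⟨u₃, hu₃, -, hl'⟩ := hq ∅ y
    have := (hV hl.symm).1 (h u₃ hu₃)
    rw [hm, hl'] at this
    exact this hy

end ClassifierScheme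

end Fairness

theorem mainTheorem11 (S : Fairness.ClassifierScheme) (hS : S.IsPolyTime) :
    S.existentialFairnessProblem ∈ PolyHierarchy.PiP 4 ∧
      S.universalFairnessProblem ∈ PolyHierarchy.PiP 3 :=
  ⟨Fairness.ClassifierScheme.existentialFairnessProblem_mem_piP hS,
    Fairness.ClassifierScheme.universalFairnessProblem_mem_piP hS⟩
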